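/- A precubical set $X$ consists of sets $X_n$ ($n\ge 0$) of $n$-cubes and face maps $d_i^k\colon X_n\to X_{n-1}$ ($n>0$, $k\in\{0,1\}$, $1\le i\le n$) with $d_i^k d_j^l=d_{j-1}^l d_i^k$ for $i<j$. Its geometric realization is $|X|=\big(\coprod_n X_n\times[0,1]^n\big)/\!\sim$ (with $X_n$ discrete), where $\sim$ is generated by $(d_i^kx,u)\sim(x,(u_1,\dots,u_{i-1},k,u_i,\dots,u_n))$ for $x\in X_{n+1}$, $u\in[0,1]^n$. A higher-dimensional automaton (HDA) $\mathcal A=(P_{\mathcal A},I_{\mathcal A},\Sigma_{\mathcal A},\lambda_{\mathcal A})$ consists of a precubical set $P_{\mathcal A}$, an initial state $I_{\mathcal A}\in(P_{\mathcal A})_0$, a finite set of labels $\Sigma_{\mathcal A}$ and a labeling function $\lambda_{\mathcal A}\colon(P_{\mathcal A})_1\to\Sigma_{\mathcal A}$ such that $\lambda_{\mathcal A}(d_i^0x)=\lambda_{\mathcal A}(d_i^1x)$ for all $2$-cubes $x$ and $i\in\{1,2\}$. The $0$-cubes are called states and the $1$-cubes edges; an edge $e$ has source $d_1^0e$ and target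 $d_1^1e$. The $1$-skeleton of $\mathcal A$ is the HDA obtained by discarding all cubes of dimension $>1$. $\mathcal A$ is bideterministic if no two distinct edges with the same source have the same label and no two distinct edges with the same target have the same label. A state is reachable if there is a (possibly empty) sequence of consecutive edges from $I_{\mathcal A}$ to it; $\mathcal A$ is accessible if all states are reachable, and connected if $|P_{\mathcal A}|$ is path-connected. Given a relation $R$ on $\Sigma_{\mathcal A}$, $\mathcal A$ is the HDA model of its $1$-skeleton with respect to $R$ if no two distinct edges with the same source and the same target have the same label and * $\lambda_{\mathcal A}(d^0_2x)\,R\,\lambda_{\mathcal A}(d^0_1x)$ for every $2$-cube $x$; * for $m\ge2$, two $m$-cubes $x,y$ with $d^k_ix=d^k_iy$ for all $i\in\{1,\dots,m\}$ and $k\in\{0,1\}$ are equal; * there is no HDA $\mathcal Q$ that has the same $1$-skeleton as $\mathcal A$ (including initial state, label set and labeling function), satisfies the two preceding conditions, and is such that $P_{\mathcal A}$ is a proper precubical subset of $P_{\mathcal Q}$. **Theorem.** Let $\mathcal A$ be a bideterministic HDA which is the HDA model of its $1$-skeleton with respect to a strict total order on $\Sigma_{\mathcal A}$. Suppose that $\mathcal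 A$ is connected and has only finitely many unreachable states. Then there exists an accessible and bideterministic HDA $\mathcal B$ which is the HDA model of its $1$-skeleton with respect to a strict total order on $\Sigma_{\mathcal B}$ and whose geometric realization $|P_{\mathcal B}|$ is homotopy equivalent to $|P_{\mathcal A}|$. -/

import Mathlib

open scoped ContinuousMap unitInterval

universe u v

/-- A precubical set. `face k i` is the face map `d^k_{i+1}`: the upper index `k ∈ {0,1}` is encoded
as a Boolean (`false` for `0`, `true` for `1`), and the lower index is counted from `0`.
The axiom is `d^k_i ∘ d^l_j = d^l_{j-1} ∘ d^k_i` for `i < j`. -/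
structure PrecubicalSet where
  cube : ℕ → Type u
  face : ∀ {n : ℕ}, Bool → Fin (n + 1) → cube (n + 1) → cube n
  face_face : ∀ {n : ℕ} (k l : Bool) (i j : Fin (n + 1)), i ≤ j → ∀ x : cube (n + 2),
    face k i (face l j.succ x) = face l j (face k i.castSucc x)

namespace PrecubicalSet

variable (X : PrecubicalSet.{u})

/-- The element `0` or `1` of the unit interval. -/
noncomputable def endpoint (k : Bool) : I := if k then 1 else 0

/-- The map `δ^k_i : [0,1]^n → [0,1]^(n+1)` inserting the endpoint `k` at position `i`. -/
noncomputable def coface {n : ℕ} (k : Bool) (i : Fin (n + 1)) (t : Fin n → I) : Fin (n + 1) → I :=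
  Fin.insertNth (α := fun _ => I) i (endpoint k) t

/-- The space `∐ₙ Xₙ × [0,1]^n` with `Xₙ` discrete, as the topological sum of one copy of
`[0,1]^n` for every `n`-cube. -/
abbrev CubeSum : Type u := Σ c : (Σ n : ℕ, X.cube n), (Fin c.1 → I)

/-- The generating relation `(d^k_i x, t) ∼ (x, δ^k_i t)`. -/
inductive Glue : X.CubeSum → X.CubeSum → Prop
  | glue {n : ℕ} (k : Bool) (i : Fin (n + 1)) (x : X.cube (n + 1)) (t : Fin n → I) :
      Glue ⟨⟨n, X.face k i x⟩, t⟩ ⟨⟨n + 1, x⟩, coface k i t⟩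

/-- The geometric realization: the quotient of `∐ₙ Xₙ × [0,1]^n` by the equivalence relation
generated by `Glue`, with the quotient topology. -/
abbrev Realization : Type u := Quot X.Glue

/-- The `m`-skeleton, consisting of the cubes of dimension at most `m`. -/
def skeleton (m : ℕ) : PrecubicalSet.{u} where
  cube n := {_x : X.cube n // n ≤ m}
  face k i x := ⟨X.face k i x.1, Nat.le_of_succ_le x.2⟩
  face_face k l i j h x := Subtype.ext (X.face_face k l i j h x.1)

end PrecubicalSet

/-- A higher-dimensional automaton with finite set of labels `L` (without final states). -/
structure HDA (L : Type v) extends PrecubicalSet.{u} where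
  init : cube 0
  finite_labels : Finite L
  label : cube 1 → L
  label_face : ∀ (x : cube 2) (i : Fin 2), label (face false i x) = label (face true i x)

namespace HDA

variable {L : Type v}

/-- No two edges with the same source have the same label. -/
def IsDeterministic (A : HDA.{u} L) : Prop :=
  ∀ e e' : A.cube 1, A.face false 0 e = A.face false 0 e' → A.label e = A.label e' → e = e'

/-- No two edges with the same target have the same label. -/
def IsCodeterministic (A : HDA.{u} L) : Prop :=
  ∀ e e' : A.cube 1, A.face true 0 e = A.face true 0 e' → A.label e = A.label e' → e = e'

def IsBideterministic (A : HDA.{u} L) : Prop :=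
  A.IsDeterministic ∧ A.IsCodeterministic

/-- No two edges with the same endpoints have the same label. -/
def IsExtensional (A : HDA.{u} L) : Prop :=
  ∀ e e' : A.cube 1, A.face false 0 e = A.face false 0 e' → A.face true 0 e = A.face true 0 e' →
    A.label e = A.label e' → e = e'

/-- A transition system is an extensional HDA without cubes of dimension greater than `1`. -/
def IsTransitionSystem (T : HDA.{u} L) : Prop :=
  T.IsExtensional ∧ ∀ n, 1 < n → IsEmpty (T.cube n)

/-- A state is reachable if there is a sequence of consecutive edges from the initial state
to it. -/
def Reachable (A : HDA.{u} L) (s : A.cube 0) : Prop :=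
  Relation.ReflTransGen
    (fun a b => ∃ e : A.cube 1, A.face false 0 e = a ∧ A.face true 0 e = b) A.init s

def IsAccessible (A : HDA.{u} L) : Prop :=
  ∀ s : A.cube 0, A.Reachable s

/-- An HDA is connected if its geometric realization is path-connected. -/
def IsConnected (A : HDA.{u} L) : Prop :=
  PathConnectedSpace A.Realization

/-- Morphisms of HDAs over the same set of labels that are the identity on labels. -/
structure Hom (A B : HDA.{u} L) where
  map : ∀ n : ℕ, A.cube n → B.cube n
  map_face : ∀ {n : ℕ} (k : Bool) (i : Fin (n + 1)) (x : A.cube (n + 1)),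
    map n (A.face k i x) = B.face k i (map (n + 1) x)
  map_init : map 0 A.init = B.init
  map_label : ∀ e : A.cube 1, B.label (map 1 e) = A.label e

def Hom.comp {A B C : HDA.{u} L} (g : Hom B C) (f : Hom A B) : Hom A C where
  map n x := g.map n (f.map n x)
  map_face k i x := by rw [f.map_face, g.map_face]
  map_init := by rw [f.map_init, g.map_init]
  map_label e := by rw [g.map_label, f.map_label]

/-- The `1`-skeleton of an HDA, with the same initial state, labels and labeling function. -/
def oneSkeleton (A : HDA.{u} L) : HDA.{u} L where
  toPrecubicalSet := A.toPrecubicalSet.skeleton 1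
  init := ⟨A.init, Nat.zero_le 1⟩
  finite_labels := A.finite_labels
  label e := A.label e.1
  label_face x i := A.label_face x.1 i

/-- The inclusion of the `1`-skeleton. -/
def oneSkeletonIncl (A : HDA.{u} L) : Hom A.oneSkeleton A where
  map _ x := x.1
  map_face _ _ _ := rfl
  map_init := rfl
  map_label _ := rfl

/-- Conditions HM1--HM3 for an HDA `Q` with respect to a transition system `T` and a relation `R` on
the labels. The identification of `T` with the `1`-skeleton of `Q` is the morphism `ι`. -/
structure SatisfiesHM123 {T Q : HDA.{u} L} (ι : Hom T Q) (R : L → L → Prop) : Prop where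
  hm1 : ∀ n, n ≤ 1 → Function.Bijective (ι.map n)
  hm2 : ∀ x : Q.cube 2, R (Q.label (Q.face false 1 x)) (Q.label (Q.face false 0 x))
  hm3 : ∀ (m : ℕ) (x y : Q.cube (m + 2)), (∀ k i, Q.face k i x = Q.face k i y) → x = y

/-- `Q` is the HDA model of the transition system `T` with respect to `R`, where `T` is identified
with the `1`-skeleton of `Q` by `ι`. Condition HM4 (maximality) says that every inclusion `f` of `Q`
into an HDA `Q'` that satisfies HM1--HM3 (with the induced identification of `T` with the
`1`-skeleton of `Q'`) is surjective. -/
structure IsHDAModel {T Q : HDA.{u} L} (ι : Hom T Q) (R : L → L → Prop) : Prop where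
  transitionSystem : T.IsTransitionSystem
  hm123 : SatisfiesHM123 ι R
  hm4 : ∀ (Q' : HDA.{u} L) (f : Hom Q Q'), (∀ n, Function.Injective (f.map n)) →
    SatisfiesHM123 (f.comp ι) R → ∀ n, Function.Surjective (f.map n)

/-- `A` is the HDA model of its `1`-skeleton with respect to `R`. -/
def IsHDAModelOfOneSkeleton (A : HDA.{u} L) (R : L → L → Prop) : Prop :=
  IsHDAModel A.oneSkeletonIncl R

end HDA

/-!
If some state of `A` is not reachable, then, by connectedness, there are an unreachable state `u`
and an edge with a label `a` from `u` to a reachable state, and so there is a zigzag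
`v 0 → ⋯ → v k ← u` in which `v 0` is the initial state. An edge from the reachable part of `A` to
`u` would in general create a new loop. Instead, `A` is enlarged by a *ladder*, which does not
change the homotopy type and which contains a new initial state: from it, one reaches all new
states, all states of `A` that were reachable before, and `u`. Since the number of unreachable
states decreases, the theorem follows by induction.

The ladder (`HDA.Zigzag.Ladder`) begins with a copy of the zigzag, mapped to the zigzag by edges
with a new label `z`. The copies of distinct states are distinct and have no further incoming
edges, so that there are no obstructions to bideterminism any more. Then the edge with label `a`
at the end of the copy is pushed back along the copy of the path by attaching squares:
```
  q_j   --> q_(j+1) --> ⋯ --> q_k          (q_k --z--> u)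
   |a        |a                |a
   v         v                 v
  p_j   --> p_(j+1) --> ⋯ --> p_k          (p_l --z--> v l)
```
If `a` is not a label of the path, this works down to `j = 0`, and `q_0` is a suitable initial
state. Otherwise, let `p_j → p_(j+1)` be the last edge of the copy with label `a`. Codeterminism
does not permit a rung at `p_(j+1)`, but the edge `p_j → p_(j+1)` can play the role of this rung:
one attaches an edge from `p_j` to `q_(j+2)` and a square, and `p_0` is a suitable initial state.
Here `j + 1 < k` because `A` is codeterministic and `u ≠ v (k - 1)`.

The construction decomposes into two kinds of steps: adding a state with one outgoing edge
(`HDA.Presents.expandState`) and adding an edge that completes exactly one square, together with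
this square (`HDA.Presents.attachSquare`). In both cases an `(n + 1)`-cube and one of its faces
are attached along the open box of the remaining faces. Such a box is a deformation retract of the
cube, by a radial projection, whence `PrecubicalSet.nonempty_homotopyEquiv_of_filler`.

The maximality in the definition of HDA models is equivalent to the condition that all boundaries
of cubes are filled (`HDA.IsFull`), with the order of the labels deciding which of the two
boundaries of a given square is filled. In this form the model property can be checked after each
step: the new edge occurs in no boundary other than that of the new square, and no boundary of a
`3`-cube contains the new square, because it would have to contain it in two directions that have
the same label.
-/

/-! ### Attaching cubes -/

namespace PrecubicalSet

variable (X : PrecubicalSet.{u})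

/-- The precubical set obtained from `X` by attaching one cube of dimension `n` along the boundary
`bd`. The boundary is indexed by all `m` with `m + 1 = n` in order to avoid casts; it is no datum
for `n = 0`. -/
def attach (n : ℕ) (bd : ∀ m, m + 1 = n → Bool → Fin (m + 1) → X.cube m)
    (hbd : ∀ m (hm : m + 2 = n) (k l : Bool) (i j : Fin (m + 1)), i ≤ j →
      X.face k i (bd (m + 1) hm l j.succ) = X.face l j (bd (m + 1) hm k i.castSucc)) :
    PrecubicalSet.{u} where
  cube m := X.cube m ⊕ PLift (m = n)
  face {m} k i x := Sum.elim (fun x => Sum.inl (X.face k i x))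
    (fun h => Sum.inl (bd m h.down k i)) x
  face_face {m} k l i j hij x := by
    rcases x with x | h
    · exact congrArg Sum.inl (X.face_face k l i j hij x)
    · exact congrArg Sum.inl (hbd m h.down k l i j hij)

/-- The boundary of a cube of dimension `n + 1` in the form in which it is used in `attach`. -/
def boundary {X : PrecubicalSet.{u}} {n : ℕ} (f : Bool → Fin (n + 1) → X.cube n) :
    ∀ m, m + 1 = n + 1 → Bool → Fin (m + 1) → X.cube m :=
  fun m h => match m, Nat.succ.inj h with | _, rfl => f

/-! ### Retraction of a cube onto an open box -/

section Box

variable {n : ℕ} (i₀ : Fin (n + 1))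

/-- Coordinates on the cube `[0,1]^(n+1)` in which the open box without the face `t i₀ = 0` is the
part of the unit sphere of the supremum norm that lies in the cube. -/
noncomputable def boxCoord (t : Fin (n + 1) → I) : Fin (n + 1) → ℝ :=
  fun j => if j = i₀ then ((t j : ℝ) + 1) / 2 else 2 * (t j : ℝ) - 1

/-- The radial push of the cube `[0,1]^(n+1)` to the open box without the face `t i₀ = 0`, at time
`s`. -/
noncomputable def boxPush (s : I) (t : Fin (n + 1) → I) : Fin (n + 1) → I := fun j =>
  Set.projIcc 0 1 zero_le_one
    (if j = i₀ then 2 * (boxCoord i₀ t j * (1 - s + s / ‖boxCoord i₀ t‖)) - 1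
      else (boxCoord i₀ t j * (1 - s + s / ‖boxCoord i₀ t‖) + 1) / 2)

lemma continuous_boxCoord : Continuous (boxCoord i₀) := by
  refine continuous_pi fun j => ?_
  unfold boxCoord
  split_ifs <;> fun_prop

lemma norm_boxCoord_pos (t : Fin (n + 1) → I) : 0 < ‖boxCoord i₀ t‖ := by
  have h := norm_le_pi_norm (boxCoord i₀ t) i₀
  have h1 : boxCoord i₀ t i₀ = ((t i₀ : ℝ) + 1) / 2 := by simp [boxCoord]
  have h2 := (t i₀).2.1
  have h3 := le_abs_self (boxCoord i₀ t i₀)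
  rw [Real.norm_eq_abs] at h
  linarith

lemma norm_boxCoord_le (t : Fin (n + 1) → I) : ‖boxCoord i₀ t‖ ≤ 1 := by
  refine (pi_norm_le_iff_of_nonneg zero_le_one).2 fun j => ?_
  have h1 := (t j).2.1
  have h2 := (t j).2.2
  rw [Real.norm_eq_abs, abs_le]
  unfold boxCoord
  split_ifs <;> constructor <;> linarith

lemma continuous_boxPush : Continuous fun p : I × (Fin (n + 1) → I) => boxPush i₀ p.1 p.2 := by
  refine continuous_pi fun j => continuous_projIcc.comp ?_
  have hc : Continuous fun p : I × (Fin (n + 1) → I) => boxCoord i₀ p.2 :=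
    (continuous_boxCoord i₀).comp continuous_snd
  have hj : Continuous fun p : I × (Fin (n + 1) → I) => boxCoord i₀ p.2 j :=
    (continuous_apply j).comp hc
  have hs : Continuous fun p : I × (Fin (n + 1) → I) => (p.1 : ℝ) :=
    continuous_subtype_val.comp continuous_fst
  have hd : Continuous fun p : I × (Fin (n + 1) → I) =>
      boxCoord i₀ p.2 j * (1 - (p.1 : ℝ) + p.1 / ‖boxCoord i₀ p.2‖) :=
    hj.mul ((continuous_const.sub hs).add
      (hs.div hc.norm fun p => (norm_boxCoord_pos i₀ p.2).ne'))
  split_ifs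
  · exact (continuous_const.mul hd).sub continuous_const
  · exact (hd.add continuous_const).div_const 2

lemma boxPush_eq_self {s : I} {t : Fin (n + 1) → I}
    (h : (s : ℝ) = 0 ∨ ‖boxCoord i₀ t‖ = 1) : boxPush i₀ s t = t := by
  funext j
  have h1 : 1 - (s : ℝ) + s / ‖boxCoord i₀ t‖ = 1 := by
    rcases h with h | h <;> simp [h]
  unfold boxPush
  rw [h1]
  refine (congrArg _ ?_).trans (Set.projIcc_val zero_le_one (t j))
  unfold boxCoord
  split_ifs <;> ring

lemma boxPush_zero (t : Fin (n + 1) → I) : boxPush i₀ 0 t = t :=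
  boxPush_eq_self i₀ (Or.inl rfl)

/-- The face `(k, i)` of the cube belongs to the open box without the face `(0, i₀)`. -/
def IsBoxFace (k : Bool) (i : Fin (n + 1)) : Prop := k = true ∨ i ≠ i₀

lemma boxPush_of_mem {s : I} {t : Fin (n + 1) → I} {k : Bool} {i : Fin (n + 1)}
    (hki : IsBoxFace i₀ k i) (ht : t i = endpoint k) : boxPush i₀ s t = t := by
  refine boxPush_eq_self i₀ (Or.inr (le_antisymm (norm_boxCoord_le i₀ t) ?_))
  refine le_trans (le_of_eq ?_) (norm_le_pi_norm (boxCoord i₀ t) i)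
  rw [Real.norm_eq_abs]
  unfold boxCoord
  rw [ht]
  rcases hki with rfl | h
  · split_ifs <;> norm_num [endpoint]
  · cases k <;> norm_num [endpoint, h]

lemma exists_boxPush_one (t : Fin (n + 1) → I) :
    ∃ k i, IsBoxFace i₀ k i ∧ boxPush i₀ 1 t i = endpoint k := by
  have hpos := norm_boxCoord_pos i₀ t
  obtain ⟨j, hj⟩ : ∃ j, ‖boxCoord i₀ t‖ = |boxCoord i₀ t j| := by
    obtain ⟨j, hj⟩ := Finite.exists_max fun j => ‖boxCoord i₀ t j‖
    exact ⟨j, le_antisymm ((pi_norm_le_iff_of_nonneg (norm_nonneg _)).2 hj)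
      (norm_le_pi_norm (boxCoord i₀ t) j)⟩
  have hval : boxPush i₀ 1 t j = Set.projIcc 0 1 zero_le_one
      (if j = i₀ then 2 * (boxCoord i₀ t j / ‖boxCoord i₀ t‖) - 1
        else (boxCoord i₀ t j / ‖boxCoord i₀ t‖ + 1) / 2) := by
    simp [boxPush, div_eq_mul_inv]
  rcases le_or_gt 0 (boxCoord i₀ t j) with h0 | h0
  · refine ⟨true, j, Or.inl rfl, ?_⟩
    rw [abs_of_nonneg h0] at hj
    rw [hval, ← hj, div_self hpos.ne']
    norm_num [endpoint]
  · have hne : j ≠ i₀ := by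
      rintro rfl
      have h1 : boxCoord j t j = ((t j : ℝ) + 1) / 2 := by simp [boxCoord]
      have h2 := (t j).2.1
      linarith
    refine ⟨false, j, Or.inr hne, ?_⟩
    rw [abs_of_neg h0] at hj
    have h1 : boxCoord i₀ t j / ‖boxCoord i₀ t‖ = -1 := by
      rw [hj, div_neg, div_self h0.ne]
    rw [hval, h1, if_neg hne]
    norm_num [endpoint]

end Box

lemma endpoint_injective : Function.Injective endpoint := by
  intro k l h
  cases k <;> cases l <;> simp [endpoint] at h ⊢

lemma coface_removeNth {n : ℕ} {k : Bool} {i : Fin (n + 1)} {t : Fin (n + 1) → I}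
    (h : t i = endpoint k) : coface k i (i.removeNth t) = t := by
  unfold coface
  rw [← h]
  exact Fin.insertNth_self_removeNth (α := fun _ => I) i t

@[simp] lemma coface_apply_same {n : ℕ} (k : Bool) (i : Fin (n + 1)) (t : Fin n → I) :
    coface k i t i = endpoint k := by simp [coface]

@[simp] lemma removeNth_coface {n : ℕ} (k : Bool) (i : Fin (n + 1)) (t : Fin n → I) :
    i.removeNth (coface k i t) = t := by
  simp [coface, Fin.removeNth_insertNth (α := fun _ => I)]

lemma castSucc_succAbove_of_le {m : ℕ} {i j : Fin (m + 1)} (h : i ≤ j) :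
    i.castSucc.succAbove j = j.succ :=
  Fin.succAbove_of_le_castSucc _ _ (by simpa using h)

lemma succ_succAbove_of_le {m : ℕ} {i j : Fin (m + 1)} (h : i ≤ j) :
    j.succ.succAbove i = i.castSucc :=
  Fin.succAbove_of_castSucc_lt _ _ (by simpa [Fin.lt_def] using Nat.lt_succ_of_le h)

lemma removeNth_removeNth_of_le {m : ℕ} {i j : Fin (m + 1)} (hle : i ≤ j)
    (t : Fin (m + 2) → I) :
    j.removeNth (i.castSucc.removeNth t) = i.removeNth (j.succ.removeNth t) := by
  funext a
  simp only [Fin.removeNth_apply]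
  congr 1
  have hle' : (i : ℕ) ≤ j := hle
  simp only [Fin.succAbove, Fin.lt_def, Fin.ext_iff]
  rcases lt_or_ge (a : ℕ) i with h | h <;> rcases lt_or_ge (a : ℕ) j with h' | h'
  · simp [h, h', Nat.lt_succ_of_lt h']
  · omega
  · simp [h.not_gt, h']
  · simp [h.not_gt, h'.not_gt, (show ¬ (a : ℕ) + 1 < i by omega)]

lemma coface_coface {m : ℕ} (k l : Bool) {i j : Fin (m + 1)} (hle : i ≤ j) (t : Fin m → I) :
    coface l j.succ (coface k i t) = coface k i.castSucc (coface l j t) := by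
  have h1 : coface k i.castSucc (coface l j t) j.succ = endpoint l := by
    have := Fin.removeNth_apply (α := fun _ => I) i.castSucc
      (coface k i.castSucc (coface l j t)) j
    rw [removeNth_coface, coface_apply_same, castSucc_succAbove_of_le hle] at this
    exact this.symm
  have h2 : j.succ.removeNth (coface k i.castSucc (coface l j t)) i = endpoint k := by
    rw [Fin.removeNth_apply, succ_succAbove_of_le hle, coface_apply_same]
  rw [← coface_removeNth h1, ← coface_removeNth h2, ← removeNth_removeNth_of_le hle]
  simp

lemma continuous_coface {n : ℕ} (k : Bool) (i : Fin (n + 1)) : Continuous (coface k i) := by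
  unfold coface
  fun_prop

/-! ### Filling an open box is a homotopy equivalence -/

section Filler

variable {X} {n : ℕ} (i₀ : Fin (n + 1)) (g : Bool → Fin (n + 1) → X.cube n)

/-- The point of the realization of a cube. -/
def pt {m : ℕ} (x : X.cube m) (t : Fin m → I) : X.Realization := Quot.mk _ ⟨⟨m, x⟩, t⟩

lemma pt_face {m : ℕ} (k : Bool) (i : Fin (m + 1)) (x : X.cube (m + 1)) (t : Fin m → I) :
    pt (X.face k i x) t = pt x (coface k i t) := Quot.sound (.glue k i x t)

lemma continuous_pt {m : ℕ} (x : X.cube m) : Continuous (pt x) :=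
  continuous_quot_mk.comp continuous_sigmaMk

/-- The faces `g k i`, for `(k, i) ≠ (0, i₀)`, fit together to an open box in `X`. -/
def IsOpenBox : Prop :=
  ∀ m (hm : m + 1 = n) (k l : Bool) (i j : Fin (m + 1)), i ≤ j →
    IsBoxFace i₀ l (j.succ.cast (by rw [hm])) → IsBoxFace i₀ k (i.castSucc.cast (by rw [hm])) →
    X.face k i (hm ▸ g l (j.succ.cast (by rw [hm]))) =
      X.face l j (hm ▸ g k (i.castSucc.cast (by rw [hm])))

open Classical in
/-- The map from the open box to the realization of `X` that is given by the faces `g k i`; outside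
of the open box the value is of no importance. -/
noncomputable def boxMap (t : Fin (n + 1) → I) : X.Realization :=
  if h : ∃ p : Bool × Fin (n + 1), IsBoxFace i₀ p.1 p.2 ∧ t p.2 = endpoint p.1 then
    pt (g h.choose.1 h.choose.2) (h.choose.2.removeNth t)
  else pt (g true i₀) (i₀.removeNth t)

variable {i₀ g}

lemma pt_eq_of_lt (hg : IsOpenBox i₀ g) {k l : Bool} {i j : Fin (n + 1)} (hij : i < j)
    (hk : IsBoxFace i₀ k i) (hl : IsBoxFace i₀ l j) {t : Fin (n + 1) → I}
    (hti : t i = endpoint k) (htj : t j = endpoint l) :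
    pt (g k i) (i.removeNth t) = pt (g l j) (j.removeNth t) := by
  obtain ⟨m, rfl⟩ : ∃ m, n = m + 1 := ⟨n - 1, by have := i.2; have := j.2; omega⟩
  obtain ⟨i, rfl⟩ : ∃ i' : Fin (m + 1), i = i'.castSucc :=
    ⟨i.castPred (Fin.ne_last_of_lt hij), by simp⟩
  obtain ⟨j, rfl⟩ : ∃ j' : Fin (m + 1), j = j'.succ :=
    ⟨j.pred (Fin.ne_zero_of_lt hij), by simp⟩
  have hle : i ≤ j := by rw [Fin.lt_def] at hij; rw [Fin.le_def]; simp at hij; omega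
  have e1 : coface l j (j.removeNth (i.castSucc.removeNth t)) = i.castSucc.removeNth t :=
    coface_removeNth (by rw [Fin.removeNth_apply, castSucc_succAbove_of_le hle, htj])
  have e2 : coface k i (i.removeNth (j.succ.removeNth t)) = j.succ.removeNth t :=
    coface_removeNth (by rw [Fin.removeNth_apply, succ_succAbove_of_le hle, hti])
  rw [← e1, ← e2, removeNth_removeNth_of_le hle, ← pt_face, ← pt_face]
  exact congrArg (fun x => pt x _) (hg m rfl k l i j hle hl hk).symm

lemma boxMap_eq (hg : IsOpenBox i₀ g) {k : Bool} {i : Fin (n + 1)} (hk : IsBoxFace i₀ k i)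
    {t : Fin (n + 1) → I} (ht : t i = endpoint k) :
    boxMap i₀ g t = pt (g k i) (i.removeNth t) := by
  have h : ∃ p : Bool × Fin (n + 1), IsBoxFace i₀ p.1 p.2 ∧ t p.2 = endpoint p.1 := ⟨(k, i), hk, ht⟩
  rw [boxMap, dif_pos h]
  obtain ⟨h1, h2⟩ := h.choose_spec
  revert h1 h2
  generalize h.choose = p
  obtain ⟨l, j⟩ := p
  intro h1 h2
  rcases lt_trichotomy i j with hij | rfl | hij
  · exact (pt_eq_of_lt hg hij hk h1 ht h2).symm
  · obtain rfl := endpoint_injective (ht.symm.trans h2)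
    rfl
  · exact pt_eq_of_lt hg hij h1 hk h2 ht

lemma continuous_boxMap_boxPush (hg : IsOpenBox i₀ g) :
    Continuous fun t => boxMap i₀ g (boxPush i₀ 1 t) := by
  have hp : Continuous (boxPush i₀ 1) :=
    Continuous.uncurry_left (1 : I) (continuous_boxPush i₀)
  have hex := exists_boxPush_one i₀
  generalize boxPush i₀ 1 = b at hp hex
  -- The preimages of the faces of the box form a finite closed cover of the cube.
  refine (locallyFinite_of_finite (fun p : {p : Bool × Fin (n + 1) // IsBoxFace i₀ p.1 p.2} =>
    {t | b t p.1.2 = endpoint p.1.1})).continuous ?_ ?_ ?_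
  · refine Set.eq_univ_of_forall fun t => ?_
    obtain ⟨k, i, h, ht⟩ := hex t
    exact Set.mem_iUnion.2 ⟨(⟨(k, i), h⟩ : {p : Bool × Fin (n + 1) // IsBoxFace i₀ p.1 p.2}), ht⟩
  · exact fun p => isClosed_eq ((continuous_apply p.1.2).comp hp) continuous_const
  · rintro ⟨⟨k, i⟩, h⟩
    refine ContinuousOn.congr (f := fun t => pt (g k i) (i.removeNth (b t))) ?_
      fun t ht => boxMap_eq hg h ht
    refine Continuous.continuousOn ((continuous_pt _).comp (continuous_pi fun a => ?_))
    exact (continuous_apply (i.succAbove a)).comp hp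

variable (i₀ g) (bd : ∀ m, m + 1 = n → Bool → Fin (m + 1) → X.cube m)
    (hbd : ∀ m (hm : m + 2 = n) (k l : Bool) (i j : Fin (m + 1)), i ≤ j →
      X.face k i (bd (m + 1) hm l j.succ) = X.face l j (bd (m + 1) hm k i.castSucc))
    (bd' : ∀ m, m + 1 = n + 1 → Bool → Fin (m + 1) → (X.attach n bd hbd).cube m)
    (hbd' : ∀ m (hm : m + 2 = n + 1) (k l : Bool) (i j : Fin (m + 1)), i ≤ j →
      (X.attach n bd hbd).face k i (bd' (m + 1) hm l j.succ) =
        (X.attach n bd hbd).face l j (bd' (m + 1) hm k i.castSucc))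

/-- A map on the cubes of an open box filling, given by its restriction `old` to the cubes of `X`
and its restriction `new` to the filler; the missing face of the box is a face of the filler. -/
noncomputable def fillerElim {Z : Type*} (old : ∀ m, X.cube m → (Fin m → I) → Z)
    (new : (Fin (n + 1) → I) → Z)
    (P : ((X.attach n bd hbd).attach (n + 1) bd' hbd').CubeSum) : Z :=
  Sum.elim
    (Sum.elim (fun x => old P.1.1 x P.2)
      (fun h => new (coface false i₀ fun a => P.2 (a.cast h.down.symm))))
    (fun h => new fun a => P.2 (a.cast h.down.symm)) P.1.2

lemma continuous_fillerElim {Y Z : Type*} [TopologicalSpace Y] [TopologicalSpace Z]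
    {old : Y → ∀ m, X.cube m → (Fin m → I) → Z} {new : Y → (Fin (n + 1) → I) → Z}
    (hold : ∀ m x, Continuous fun p : Y × (Fin m → I) => old p.1 m x p.2)
    (hnew : Continuous fun p : Y × (Fin (n + 1) → I) => new p.1 p.2) :
    Continuous fun p : Y × ((X.attach n bd hbd).attach (n + 1) bd' hbd').CubeSum =>
      fillerElim i₀ bd hbd bd' hbd' (old p.1) (new p.1) p.2 := by
  rw [← (Homeomorph.sigmaProdDistrib.symm.trans (Homeomorph.prodComm _ _)).comp_continuous_iff']
  refine continuous_sigma fun c => ?_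
  obtain ⟨m, (x | ⟨⟨rfl⟩⟩) | ⟨⟨rfl⟩⟩⟩ := c
  · exact (hold m x).comp continuous_swap
  · exact hnew.comp (continuous_snd.prodMk ((continuous_coface false i₀).comp continuous_fst))
  · exact hnew.comp continuous_swap

variable {i₀ g bd hbd bd'}

lemma isOpenBox_of_filler
    (hbd' : ∀ m (hm : m + 2 = n + 1) (k l : Bool) (i j : Fin (m + 1)), i ≤ j →
      (X.attach n bd hbd).face k i (bd' (m + 1) hm l j.succ) =
        (X.attach n bd hbd).face l j (bd' (m + 1) hm k i.castSucc))
    (hg : ∀ k i, IsBoxFace i₀ k i → bd' n rfl k i = Sum.inl (g k i)) : IsOpenBox i₀ g := by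
  rintro m rfl k l i j hij hl hk
  have h := hbd' m rfl k l i j hij
  rw [hg l j.succ hl, hg k i.castSucc hk] at h
  exact Sum.inl_injective h

variable {hbd'}

/-- A map on the cubes of an open box filling descends to the realization if its restriction to `X`
does and its restriction to the filler is compatible with it on the box. No condition is needed on
the boundary of the missing face, as it lies in the box. -/
lemma fillerElim_glue (hfree : bd' n rfl false i₀ = Sum.inr ⟨rfl⟩)
    (hg : ∀ k i, IsBoxFace i₀ k i → bd' n rfl k i = Sum.inl (g k i))
    {Z : Type*} {old : ∀ m, X.cube m → (Fin m → I) → Z} {new : (Fin (n + 1) → I) → Z}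
    (hold : ∀ m k i (x : X.cube (m + 1)) t, old m (X.face k i x) t = old (m + 1) x (coface k i t))
    (hnew : ∀ k i, IsBoxFace i₀ k i → ∀ t, new (coface k i t) = old n (g k i) t)
    {P Q : ((X.attach n bd hbd).attach (n + 1) bd' hbd').CubeSum} (hPQ : Glue _ P Q) :
    fillerElim i₀ bd hbd bd' hbd' old new P = fillerElim i₀ bd hbd bd' hbd' old new Q := by
  obtain ⟨k, i, x, t⟩ := hPQ
  rename_i m
  rcases x with (x | ⟨⟨rfl⟩⟩) | ⟨⟨h⟩⟩
  · exact hold m k i x t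
  · change old m (bd m rfl k i) t = new (coface false i₀ (coface k i t))
    rcases lt_or_ge i.castSucc i₀ with h | h
    · obtain ⟨j, rfl⟩ : ∃ j : Fin (m + 1), i₀ = j.succ :=
        ⟨i₀.pred (Fin.ne_zero_of_lt h), by simp⟩
      have hij : i ≤ j := by rw [Fin.lt_def] at h; rw [Fin.le_def]; simp at h; omega
      have hb : IsBoxFace j.succ k i.castSucc := Or.inr h.ne
      have e := hbd' m rfl k false i j hij
      rw [hfree, hg _ _ hb] at e
      rw [coface_coface _ _ hij, hnew _ _ hb, ← hold, ← Sum.inl_injective e]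
    · obtain ⟨j, rfl⟩ : ∃ j : Fin (m + 1), i₀ = j.castSucc :=
        ⟨i₀.castPred (Fin.ne_last_of_lt (lt_of_le_of_lt h i.castSucc_lt_succ)), by simp⟩
      have hij : j ≤ i := h
      have hb : IsBoxFace j.castSucc k i.succ :=
        Or.inr (lt_of_le_of_lt h i.castSucc_lt_succ).ne'
      have e := hbd' m rfl false k j i hij
      rw [hfree, hg _ _ hb] at e
      rw [← coface_coface _ _ hij, hnew _ _ hb, ← hold, Sum.inl_injective e]
  · obtain rfl := Nat.succ_injective h
    change fillerElim i₀ bd hbd bd' hbd' old new ⟨⟨m, Sum.inl (bd' m rfl k i)⟩, t⟩ =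
      new (coface k i t)
    by_cases hb : IsBoxFace i₀ k i
    · rw [hg k i hb, hnew k i hb]
      rfl
    · obtain ⟨rfl, rfl⟩ : k = false ∧ i = i₀ := by
        unfold IsBoxFace at hb
        push Not at hb
        simpa using hb
      rw [hfree]
      rfl

/-- Attaching a cube together with one of its faces along an open box does not change the homotopy
type of the realization. -/
theorem nonempty_homotopyEquiv_of_filler (hfree : bd' n rfl false i₀ = Sum.inr ⟨rfl⟩)
    (hg : ∀ k i, IsBoxFace i₀ k i → bd' n rfl k i = Sum.inl (g k i)) :
    Nonempty (((X.attach n bd hbd).attach (n + 1) bd' hbd').Realization ≃ₕ X.Realization) := by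
  have hbox : IsOpenBox i₀ g := isOpenBox_of_filler hbd' hg
  let Y := (X.attach n bd hbd).attach (n + 1) bd' hbd'
  let ι : ∀ m, X.cube m → Y.cube m := fun m x => Sum.inl (Sum.inl x)
  let c : Y.cube (n + 1) := Sum.inr ⟨rfl⟩
  have hc : ∀ k i, IsBoxFace i₀ k i → Y.face k i c = ι n (g k i) := fun k i h =>
    congrArg Sum.inl (hg k i h)
  -- The inclusion of `X`.
  let j : C(X.Realization, Y.Realization) :=
    ⟨Quot.lift (fun P => pt (ι P.1.1 P.1.2) P.2) (by
      rintro _ _ ⟨k, i, x, t⟩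
      exact pt_face (X := Y) k i (ι _ x) t),
    continuous_quot_lift _ (continuous_sigma fun c => continuous_pt (X := Y) (ι c.1 c.2))⟩
  -- The retraction pushes the filler to the open box.
  let ρ : C(Y.Realization, X.Realization) :=
    ⟨Quot.lift (fillerElim i₀ bd hbd bd' hbd' (fun m x t => pt x t)
        fun t => boxMap i₀ g (boxPush i₀ 1 t)) (fun P Q h =>
      fillerElim_glue hfree hg (fun m k i x t => pt_face k i x t) (fun k i h t => by
        rw [boxPush_of_mem i₀ h (coface_apply_same k i t),
          boxMap_eq hbox h (coface_apply_same k i t), removeNth_coface]) h),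
    continuous_quot_lift _ (((continuous_fillerElim i₀ bd hbd bd' hbd' (Y := Unit)
        (old := fun _ m x t => pt x t) (new := fun _ t => boxMap i₀ g (boxPush i₀ 1 t))
        (fun m x => (continuous_pt x).comp continuous_snd)
        ((continuous_boxMap_boxPush hbox).comp continuous_snd))).comp
        (Continuous.prodMk_right ()))⟩
  let F : I × Y.CubeSum → Y.Realization := fun p =>
    fillerElim i₀ bd hbd bd' hbd' (fun m x t => pt (ι m x) t)
      (fun t => pt c (boxPush i₀ p.1 t)) p.2
  have hF : ∀ s P Q, Y.Glue P Q → F (s, P) = F (s, Q) := fun s P Q h =>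
    fillerElim_glue hfree hg (fun m k i x t => pt_face (X := Y) k i (ι _ x) t)
      (fun k i h t => by
        rw [boxPush_of_mem i₀ h (coface_apply_same k i t), ← pt_face, hc k i h]) h
  have hFc : Continuous F := continuous_fillerElim i₀ bd hbd bd' hbd' (Y := I)
    (old := fun _ m x t => pt (ι m x) t) (new := fun s t => pt c (boxPush i₀ s t))
    (fun m x => (continuous_pt (X := Y) (ι m x)).comp continuous_snd)
    ((continuous_pt c).comp (continuous_boxPush i₀))
  let H : I × Y.Realization → Y.Realization := fun p =>
    Quot.lift (fun P => F (p.1, P)) (hF p.1) p.2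
  have hHc : Continuous H :=
    Topology.IsQuotientMap.continuous_lift_prod_right (f := Quot.mk Y.Glue)
      isQuotientMap_quot_mk hFc
  have hH0 : ∀ y, H (0, y) = y := by
    rintro ⟨⟨m, (x | ⟨⟨rfl⟩⟩) | ⟨⟨rfl⟩⟩⟩, t⟩
    · rfl
    · change pt c (boxPush i₀ 0 (coface false i₀ t)) = _
      rw [boxPush_zero, ← pt_face]
      exact congrArg (fun z => pt (X := Y) (Sum.inl z) t) hfree
    · change pt c (boxPush i₀ 0 t) = _
      rw [boxPush_zero]
      rfl
  have hbj : ∀ t, pt c (boxPush i₀ 1 t) = j (boxMap i₀ g (boxPush i₀ 1 t)) := by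
    intro t
    obtain ⟨k, i, h, ht⟩ := exists_boxPush_one i₀ t
    rw [boxMap_eq hbox h ht]
    conv_lhs => rw [← coface_removeNth ht, ← pt_face, hc k i h]
    rfl
  have hH1 : ∀ y, H (1, y) = j (ρ y) := by
    rintro ⟨⟨m, (x | ⟨⟨rfl⟩⟩) | ⟨⟨rfl⟩⟩⟩, t⟩
    · rfl
    · exact hbj _
    · exact hbj _
  refine ⟨⟨ρ, j, ⟨ContinuousMap.Homotopy.symm ⟨⟨H, hHc⟩, hH0, hH1⟩⟩, ?_⟩⟩
  have : ρ.comp j = ContinuousMap.id _ := by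
    ext y
    obtain ⟨P, rfl⟩ := Quot.exists_rep y
    rfl
  rw [this]

end Filler

end PrecubicalSet

lemma PrecubicalSet.boundary_two_compat {X : PrecubicalSet.{u}} {f : Bool → Fin 2 → X.cube 1}
    (hf : ∀ k l, X.face k 0 (f l 1) = X.face l 0 (f k 0)) (m : ℕ) (hm : m + 2 = 2) (k l : Bool)
    (i j : Fin (m + 1)) (_ : i ≤ j) :
    X.face k i (boundary f (m + 1) hm l j.succ) =
      X.face l j (boundary f (m + 1) hm k i.castSucc) := by
  obtain rfl : m = 0 := by omega
  obtain rfl : i = 0 := Fin.fin_one_eq_zero i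
  obtain rfl : j = 0 := Fin.fin_one_eq_zero j
  exact hf k l

namespace HDA

variable {L : Type v}

/-! ### HDA models and fillers of boundaries -/

/-- Every boundary of a cube of dimension at least `2` is filled by exactly one cube, where the
boundary of a `2`-cube has to be labelled in accordance with `r`. For extensional HDAs, this is the
property of being the HDA model of the `1`-skeleton. -/
structure IsFull (A : HDA.{u} L) (r : L → L → Prop) : Prop where
  rel : ∀ x : A.cube 2, r (A.label (A.face false 1 x)) (A.label (A.face false 0 x))
  eq_of_face : ∀ (m : ℕ) (x y : A.cube (m + 2)), (∀ k i, A.face k i x = A.face k i y) → x = y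
  fill_two : ∀ f : Bool → Fin 2 → A.cube 1, (∀ k l, A.face k 0 (f l 1) = A.face l 0 (f k 0)) →
    (∀ i, A.label (f false i) = A.label (f true i)) →
    r (A.label (f false 1)) (A.label (f false 0)) → ∃ x, ∀ k i, A.face k i x = f k i
  fill : ∀ (m : ℕ) (f : Bool → Fin (m + 3) → A.cube (m + 2)),
    (∀ k l (i j : Fin (m + 2)), i ≤ j →
      A.face k i (f l j.succ) = A.face l j (f k i.castSucc)) → ∃ x, ∀ k i, A.face k i x = f k i

/-- The HDA obtained by attaching one cube of dimension `n`, which is labelled by `lab` if it is an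
edge. -/
def attach (A : HDA.{u} L) (n : ℕ) (bd : ∀ m, m + 1 = n → Bool → Fin (m + 1) → A.cube m)
    (hbd : ∀ m (hm : m + 2 = n) (k l : Bool) (i j : Fin (m + 1)), i ≤ j →
      A.face k i (bd (m + 1) hm l j.succ) = A.face l j (bd (m + 1) hm k i.castSucc))
    (lab : 1 = n → L)
    (hlab : ∀ (h : 1 + 1 = n) (i : Fin 2),
      A.label (bd 1 h false i) = A.label (bd 1 h true i)) : HDA.{u} L where
  toPrecubicalSet := A.toPrecubicalSet.attach n bd hbd
  init := Sum.inl A.init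
  finite_labels := A.finite_labels
  label := Sum.elim A.label fun h => lab h.down
  label_face x i := by
    rcases x with x | h
    · exact A.label_face x i
    · exact hlab h.down i

section Attach

variable (A : HDA.{u} L) {n : ℕ} (bd : ∀ m, m + 1 = n → Bool → Fin (m + 1) → A.cube m)
    (hbd : ∀ m (hm : m + 2 = n) (k l : Bool) (i j : Fin (m + 1)), i ≤ j →
      A.face k i (bd (m + 1) hm l j.succ) = A.face l j (bd (m + 1) hm k i.castSucc))
    (lab : 1 = n → L)
    (hlab : ∀ (h : 1 + 1 = n) (i : Fin 2), A.label (bd 1 h false i) = A.label (bd 1 h true i))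

/-- The inclusion of an HDA into the HDA obtained by attaching a cube. -/
def attachIncl : Hom A (A.attach n bd hbd lab hlab) where
  map _ x := Sum.inl x
  map_face _ _ _ := rfl
  map_init := rfl
  map_label _ := rfl

end Attach

/-- If a boundary in an HDA model had no filler, then attaching one would contradict the maximality
of the model. -/
lemma IsHDAModelOfOneSkeleton.exists_filler {A : HDA.{u} L} {r : L → L → Prop}
    (hA : A.IsHDAModelOfOneSkeleton r) {n : ℕ}
    (bd : ∀ m, m + 1 = n → Bool → Fin (m + 1) → A.cube m)
    (hbd : ∀ m (hm : m + 2 = n) (k l : Bool) (i j : Fin (m + 1)), i ≤ j →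
      A.face k i (bd (m + 1) hm l j.succ) = A.face l j (bd (m + 1) hm k i.castSucc))
    (hn : 2 ≤ n)
    (hlab : ∀ (h : 1 + 1 = n) (i : Fin 2), A.label (bd 1 h false i) = A.label (bd 1 h true i))
    (hr : ∀ h : 1 + 1 = n, r (A.label (bd 1 h false 1)) (A.label (bd 1 h false 0))) :
    ∃ (m : ℕ) (h : m + 1 = n) (x : A.cube (m + 1)), ∀ k i, A.face k i x = bd m h k i := by
  by_contra hno
  push Not at hno
  let Q := A.attach n bd hbd (fun h => absurd h (by omega)) hlab
  let f : Hom A Q := A.attachIncl bd hbd _ hlab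
  have hf : ∀ n, Function.Injective (f.map n) := fun n => Sum.inl_injective
  have hQ : SatisfiesHM123 (f.comp A.oneSkeletonIncl) r := by
    refine ⟨fun m hm => ⟨?_, ?_⟩, ?_, ?_⟩
    · intro x y h
      exact Subtype.ext (hf m h)
    · rintro (x | ⟨⟨h⟩⟩)
      · exact ⟨⟨x, hm⟩, rfl⟩
      · omega
    · rintro (x | ⟨⟨h⟩⟩)
      · exact hA.hm123.hm2 x
      · exact hr h
    · have key : ∀ (m : ℕ) (x : A.cube (m + 2)) (h : m + 2 = n),
          ¬ ∀ k i, Q.face k i (Sum.inl x : Q.cube (m + 2)) = Q.face k i (Sum.inr ⟨h⟩) := by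
        intro m x h hx
        obtain ⟨k, i, hki⟩ := hno (m + 1) h x
        exact hki (Sum.inl_injective (hx k i))
      rintro m (x | ⟨⟨h⟩⟩) (y | ⟨⟨h'⟩⟩) hxy
      · exact congrArg Sum.inl (hA.hm123.hm3 m x y fun k i => Sum.inl_injective (hxy k i))
      · exact (key m x h' hxy).elim
      · exact (key m y h fun k i => (hxy k i).symm).elim
      · rfl
  obtain ⟨x, hx⟩ := hA.hm4 Q f hf hQ n (Sum.inr ⟨rfl⟩)
  exact Sum.inl_ne_inr hx

lemma IsHDAModelOfOneSkeleton.isFull {A : HDA.{u} L} {r : L → L → Prop}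
    (hA : A.IsHDAModelOfOneSkeleton r) : A.IsFull r := by
  refine ⟨hA.hm123.hm2, hA.hm123.hm3, ?_, ?_⟩
  · intro f hf hl hr
    obtain ⟨m, h, x, hx⟩ := hA.exists_filler (n := 2)
      (PrecubicalSet.boundary f)
      (by
        rintro m hm k l i j -
        obtain rfl : m = 0 := by omega
        obtain rfl := Fin.fin_one_eq_zero i
        obtain rfl := Fin.fin_one_eq_zero j
        exact hf k l)
      le_rfl (fun _ => hl) (fun _ => hr)
    obtain rfl : m = 1 := by omega
    exact ⟨x, hx⟩
  · intro m f hf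
    obtain ⟨m', h, x, hx⟩ := hA.exists_filler (n := m + 3)
      (PrecubicalSet.boundary f)
      (by
        rintro m' hm k l i j hij
        obtain rfl : m' = m + 1 := by omega
        exact hf k l i j hij)
      (by omega) (by omega) (by omega)
    obtain rfl : m' = m + 2 := by omega
    exact ⟨x, hx⟩

lemma IsFull.isHDAModelOfOneSkeleton {A : HDA.{u} L} {r : L → L → Prop} (hA : A.IsFull r)
    (hext : A.IsExtensional) : A.IsHDAModelOfOneSkeleton r := by
  refine ⟨⟨?_, ?_⟩, ⟨?_, hA.rel, hA.eq_of_face⟩, ?_⟩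
  · intro e e' h0 h1 hl
    exact Subtype.ext (hext e.1 e'.1 (congrArg Subtype.val h0) (congrArg Subtype.val h1) hl)
  · exact fun n hn => ⟨fun x => absurd x.2 (by omega)⟩
  · exact fun n hn => ⟨Subtype.val_injective, fun x => ⟨⟨x, hn⟩, rfl⟩⟩
  · intro Q f hf hQ n
    induction n with
    | zero =>
      intro y
      obtain ⟨x, hx⟩ := (hQ.hm1 0 (by omega)).2 y
      exact ⟨x.1, hx⟩
    | succ n ih =>
      intro y
      -- The faces of `y` lie in `A`, hence so does `y` if the boundary is filled in `A`.
      choose g hg using fun k i => ih (Q.face k i y)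
      have hsurj : (∃ x, ∀ k i, A.face k i x = g k i) → 1 ≤ n → ∃ x, f.map (n + 1) x = y := by
        rintro ⟨x, hx⟩ hn
        obtain ⟨n, rfl⟩ := Nat.exists_eq_add_of_le' hn
        refine ⟨x, hQ.hm3 n _ _ fun k i => ?_⟩
        rw [← f.map_face, hx, hg]
      match n with
      | 0 =>
        obtain ⟨x, hx⟩ := (hQ.hm1 1 le_rfl).2 y
        exact ⟨x.1, hx⟩
      | 1 =>
        refine hsurj (hA.fill_two g (fun k l => ?_) (fun i => ?_) ?_) le_rfl
        · refine hf 0 ?_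
          rw [f.map_face, f.map_face, hg, hg]
          exact Q.face_face k l 0 0 le_rfl y
        · rw [← f.map_label, ← f.map_label, hg, hg]
          exact Q.label_face y i
        · rw [← f.map_label, ← f.map_label, hg, hg]
          exact hQ.hm2 y
      | m + 2 =>
        refine hsurj (hA.fill m g fun k l i j hij => hf _ ?_) (by omega)
        rw [f.map_face, f.map_face, hg, hg]
        exact Q.face_face k l i j hij y

lemma IsDeterministic.isExtensional {A : HDA.{u} L} (hA : A.IsDeterministic) :
    A.IsExtensional := fun e e' h _ hl => hA e e' h hl

/-! ### Elementary expansions of HDAs -/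

section Expansion

variable (A : HDA.{u} L)

/-- The HDA obtained by adding an isolated state. -/
def attachState : HDA.{u} L :=
  A.attach 0 (fun _ h => absurd h (by omega)) (fun _ h => absurd h (by omega))
    (fun h => absurd h (by omega)) (fun h => absurd h (by omega))

/-- The HDA obtained by adding an edge from `x` to `y` with label `b`. -/
def attachEdge (x y : A.cube 0) (b : L) : HDA.{u} L :=
  A.attach 1 (PrecubicalSet.boundary fun k _ => bif k then y else x)
    (fun _ h => absurd h (by omega)) (fun _ => b) (fun h => absurd h (by omega))

/-- The HDA obtained by adding a `2`-cube with boundary `f`. -/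
def attachSquare (f : Bool → Fin 2 → A.cube 1)
    (hf : ∀ k l, A.face k 0 (f l 1) = A.face l 0 (f k 0))
    (hl : ∀ i, A.label (f false i) = A.label (f true i)) : HDA.{u} L :=
  A.attach 2 (PrecubicalSet.boundary f)
    (PrecubicalSet.boundary_two_compat hf) (fun h => absurd h (by omega)) (fun _ => hl)

/-- The HDA obtained by adding a new state and an edge with label `z` from it to `y`. -/
def expandState (y : A.cube 0) (z : L) : HDA.{u} L :=
  A.attachState.attachEdge (Sum.inr ⟨rfl⟩) (Sum.inl y) z

lemma nonempty_homotopyEquiv_expandState (y : A.cube 0) (z : L) :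
    Nonempty ((A.expandState y z).Realization ≃ₕ A.Realization) := by
  refine PrecubicalSet.nonempty_homotopyEquiv_of_filler (X := A.toPrecubicalSet) (n := 0)
    (i₀ := 0) (g := fun _ _ => y) (bd := fun _ h => absurd h (by omega))
    (hbd := fun _ h => absurd h (by omega))
    (bd' := PrecubicalSet.boundary fun k _ => bif k then Sum.inl y else Sum.inr ⟨rfl⟩)
    (hbd' := fun _ h => absurd h (by omega)) rfl ?_
  rintro k i (rfl | h)
  · rfl
  · exact absurd (Fin.fin_one_eq_zero i) h

lemma expandState_cube_cases (y : A.cube 0) (z : L) (e : (A.expandState y z).cube 1) :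
    e = Sum.inr ⟨rfl⟩ ∨ ∃ e' : A.cube 1, e = Sum.inl (Sum.inl e') := by
  rcases e with (e | ⟨⟨h⟩⟩) | _
  · exact Or.inr ⟨e, rfl⟩
  · omega
  · exact Or.inl rfl

variable {A}

lemma IsFull.expandState {r : L → L → Prop} (hr : ∀ a, ¬ r a a) (hA : A.IsFull r)
    (y : A.cube 0) (z : L) : (A.expandState y z).IsFull r := by
  have hold : ∀ m (x : (A.expandState y z).cube (m + 2)),
      ∃ x' : A.cube (m + 2), x = Sum.inl (Sum.inl x') := by
    rintro m ((x | ⟨⟨h⟩⟩) | ⟨⟨h⟩⟩)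
    · exact ⟨x, rfl⟩
    · omega
    · omega
  have hinj : ∀ m, Function.Injective
      (fun x : A.cube m => (Sum.inl (Sum.inl x) : (A.expandState y z).cube m)) :=
    fun m => Sum.inl_injective.comp Sum.inl_injective
  -- The new state is the source of the new edge and incident with no other edge.
  have hnew : ∀ (k : Bool) (e : (A.expandState y z).cube 1),
      (A.expandState y z).face k 0 e = Sum.inl (Sum.inr ⟨rfl⟩) → e = Sum.inr ⟨rfl⟩ := by
    intro k e h
    rcases A.expandState_cube_cases y z e with rfl | ⟨e, rfl⟩
    · rfl
    · exact (Sum.inl_ne_inr (Sum.inl_injective h)).elim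
  refine ⟨fun x => ?_, fun m x x' h => ?_, fun f hf hl hfr => ?_, fun m f hf => ?_⟩
  · obtain ⟨x, rfl⟩ := hold 0 x
    exact hA.rel x
  · obtain ⟨x, rfl⟩ := hold m x
    obtain ⟨x', rfl⟩ := hold m x'
    exact congrArg _ (congrArg _ (hA.eq_of_face m x x' fun k i =>
      Sum.inl_injective (Sum.inl_injective (h k i))))
  · have hfe : ∀ k i, ∃ e : A.cube 1, f k i = Sum.inl (Sum.inl e) := by
      intro l j
      refine (A.expandState_cube_cases y z (f l j)).resolve_left fun h => ?_
      -- If the boundary contained the new edge, then it would contain it in both directions.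
      have key : f false 0 = Sum.inr ⟨rfl⟩ ∧ f false 1 = Sum.inr ⟨rfl⟩ := by
        have step0 : ∀ l, f l 0 = Sum.inr ⟨rfl⟩ → f false 1 = Sum.inr ⟨rfl⟩ := fun l h =>
          hnew l _ ((hf l false).trans (by rw [h]; rfl))
        have step1 : ∀ l, f l 1 = Sum.inr ⟨rfl⟩ → f false 0 = Sum.inr ⟨rfl⟩ := fun l h =>
          hnew l _ ((hf false l).symm.trans (by rw [h]; rfl))
        obtain rfl | rfl : j = 0 ∨ j = 1 := by omega
        · exact ⟨step1 _ (step0 l h), step0 l h⟩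
        · exact ⟨step1 l h, step0 _ (step1 l h)⟩
      rw [key.1, key.2] at hfr
      exact hr _ hfr
    choose g hg using hfe
    simp only [hg] at hf hl hfr
    obtain ⟨x, hx⟩ := hA.fill_two g (fun k l => hinj 0 (hf k l)) hl hfr
    exact ⟨Sum.inl (Sum.inl x), fun k i => (congrArg _ (congrArg _ (hx k i))).trans (hg k i).symm⟩
  · choose g hg using fun k i => hold m (f k i)
    simp only [hg] at hf
    obtain ⟨x, hx⟩ := hA.fill m g fun k l i j hij => hinj _ (hf k l i j hij)
    exact ⟨Sum.inl (Sum.inl x), fun k i => (congrArg _ (congrArg _ (hx k i))).trans (hg k i).symm⟩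

variable (A)

/-- The new edge of `A.attachEdge x y b`. -/
def newEdge (x y : A.cube 0) (b : L) : (A.attachEdge x y b).cube 1 := Sum.inr ⟨rfl⟩

variable {A} {x y : A.cube 0} {b : L}
  {f : Bool → Fin 2 → (A.attachEdge x y b).cube 1}
  {hf : ∀ k l, (A.attachEdge x y b).face k 0 (f l 1) = (A.attachEdge x y b).face l 0 (f k 0)}
  {hl : ∀ i, (A.attachEdge x y b).label (f false i) = (A.attachEdge x y b).label (f true i)}
  {i₀ : Fin 2} {g : Bool → Fin 2 → A.cube 1}

lemma nonempty_homotopyEquiv_attachSquare (hfree : f false i₀ = A.newEdge x y b)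
    (hg : ∀ k i, PrecubicalSet.IsBoxFace i₀ k i → f k i = Sum.inl (g k i)) :
    Nonempty (((A.attachEdge x y b).attachSquare f hf hl).Realization ≃ₕ A.Realization) :=
  PrecubicalSet.nonempty_homotopyEquiv_of_filler (X := A.toPrecubicalSet) (n := 1) (i₀ := i₀)
    (g := g) (bd := PrecubicalSet.boundary fun k _ => bif k then y else x)
    (hbd := fun _ h => absurd h (by omega)) (bd' := PrecubicalSet.boundary f)
    (hbd' := PrecubicalSet.boundary_two_compat hf)
    hfree hg

/-- An HDA remains full if an edge and a `2`-cube are attached along the other three faces of the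
`2`-cube, provided the boundary of the `2`-cube is the only one that contains the new edge. -/
lemma IsFull.attachSquare {r : L → L → Prop} (hr : ∀ a, ¬ r a a) (hA : A.IsFull r)
    (hfree : f false i₀ = A.newEdge x y b)
    (hg : ∀ k i, PrecubicalSet.IsBoxFace i₀ k i → f k i = Sum.inl (g k i))
    (hfr : r ((A.attachEdge x y b).label (f false 1)) ((A.attachEdge x y b).label (f false 0)))
    (huniq : ∀ f' : Bool → Fin 2 → (A.attachEdge x y b).cube 1,
      (∀ k l, (A.attachEdge x y b).face k 0 (f' l 1) = (A.attachEdge x y b).face l 0 (f' k 0)) →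
      (∀ i, (A.attachEdge x y b).label (f' false i) = (A.attachEdge x y b).label (f' true i)) →
      r ((A.attachEdge x y b).label (f' false 1)) ((A.attachEdge x y b).label (f' false 0)) →
      (∃ k i, f' k i = A.newEdge x y b) → f' = f) :
    ((A.attachEdge x y b).attachSquare f hf hl).IsFull r := by
  set B := (A.attachEdge x y b).attachSquare f hf hl with hB
  have hinj : ∀ m, Function.Injective
      (fun x : A.cube m => (Sum.inl (Sum.inl x) : B.cube m)) :=
    fun m => Sum.inl_injective.comp Sum.inl_injective
  let c : B.cube 2 := Sum.inr ⟨rfl⟩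
  let e : B.cube 1 := Sum.inl (A.newEdge x y b)
  have hce : B.face false i₀ c = e := congrArg Sum.inl hfree
  have hcases : ∀ x : B.cube 2, x = c ∨ ∃ x' : A.cube 2, x = Sum.inl (Sum.inl x') := by
    rintro ((x | ⟨⟨h⟩⟩) | _)
    · exact Or.inr ⟨x, rfl⟩
    · omega
    · exact Or.inl rfl
  have hcases' : ∀ m (x : B.cube (m + 3)), ∃ x' : A.cube (m + 3), x = Sum.inl (Sum.inl x') := by
    rintro m ((x | ⟨⟨h⟩⟩) | ⟨⟨h⟩⟩)
    · exact ⟨x, rfl⟩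
    · omega
    · omega
  have hold : ∀ k i (x : A.cube 2), B.face k i (Sum.inl (Sum.inl x)) ≠ e := fun k i x h =>
    Sum.inl_ne_inr (Sum.inl_injective h)
  have hface : ∀ k i (x : B.cube 2), B.face k i x = e → x = c ∧ k = false ∧ i = i₀ := by
    intro k i x h
    rcases hcases x with rfl | ⟨x, rfl⟩
    · refine ⟨rfl, ?_⟩
      by_contra hki
      have hb : PrecubicalSet.IsBoxFace i₀ k i := by
        unfold PrecubicalSet.IsBoxFace
        cases k <;> simp_all
      have := (Sum.inl_injective h : f k i = _)
      rw [hg k i hb] at this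
      exact Sum.inl_ne_inr this
    · exact (hold k i x h).elim
  have hrel : ∀ x : B.cube 2, r (B.label (B.face false 1 x)) (B.label (B.face false 0 x)) := by
    intro x
    rcases hcases x with rfl | ⟨x, rfl⟩
    · exact hfr
    · exact hA.rel x
  refine ⟨hrel, fun m x x' h => ?_, fun f' hf' hl' hfr' => ?_, fun m f' hf' => ?_⟩
  · match m with
    | 0 =>
      rcases hcases x with rfl | ⟨x, rfl⟩ <;> rcases hcases x' with rfl | ⟨x', rfl⟩
      · rfl
      · exact (hold _ _ x' ((h false i₀).symm.trans hce)).elim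
      · exact (hold _ _ x ((h false i₀).trans hce)).elim
      · exact congrArg _ (congrArg _ (hA.eq_of_face 0 x x' fun k i => hinj 1 (h k i)))
    | m + 1 =>
      obtain ⟨x, rfl⟩ := hcases' m x
      obtain ⟨x', rfl⟩ := hcases' m x'
      exact congrArg _ (congrArg _ (hA.eq_of_face (m + 1) x x' fun k i => hinj _ (h k i)))
  · have h1 : ∀ k i, ∃ e : (A.attachEdge x y b).cube 1, f' k i = Sum.inl e := by
      intro k i
      rcases f' k i with e | ⟨⟨h⟩⟩
      · exact ⟨e, rfl⟩
      · omega
    choose f'' hf'' using h1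
    simp only [hf''] at hf' hl' hfr'
    by_cases hex : ∃ k i, f'' k i = A.newEdge x y b
    · have := huniq f'' (fun k l => Sum.inl_injective (hf' k l)) hl' hfr' hex
      refine ⟨c, fun k i => ?_⟩
      rw [hf'', this]
      rfl
    · push Not at hex
      have h2 : ∀ k i, ∃ e : A.cube 1, f'' k i = Sum.inl e := by
        intro k i
        rcases h : f'' k i with e | _
        · exact ⟨e, rfl⟩
        · exact (hex k i h).elim
      choose g' hg' using h2
      simp only [hg'] at hf' hl' hfr' hf''
      obtain ⟨x, hx⟩ := hA.fill_two g' (fun k l => hinj 0 (hf' k l)) hl' hfr'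
      exact ⟨Sum.inl (Sum.inl x), fun k i =>
        (congrArg _ (congrArg _ (hx k i))).trans (hf'' k i).symm⟩
  · have h1 : ∀ k i, ∃ x : A.cube (m + 2), f' k i = Sum.inl (Sum.inl x) := by
      match m with
      | 0 =>
        intro l j
        refine (hcases (f' l j)).resolve_left fun h => ?_
        -- A boundary that contains the new `2`-cube contains it in two directions, and the labels
        -- of these directions agree; the `2`-cube in the plane of these directions would then
        -- violate the relation between the labels.
        have hfin : ∀ i : Fin 2, i = 0 ∨ i = 1 := by omega
        have hfin' : ∀ i : Fin 3, i = 0 ∨ i = 1 ∨ i = 2 := by omega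
        have c00 : ∀ k l, B.face k 0 (f' l 1) = B.face l 0 (f' k 0) := fun k l =>
          hf' k l 0 0 le_rfl
        have c01 : ∀ k l, B.face k 0 (f' l 2) = B.face l 1 (f' k 0) := fun k l =>
          hf' k l 0 1 (Fin.zero_le 1)
        have c11 : ∀ k l, B.face k 1 (f' l 2) = B.face l 1 (f' k 1) := fun k l =>
          hf' k l 1 1 le_rfl
        rcases hfin i₀ with rfl | rfl
        · have key : f' false 0 = c ∧ f' false 1 = c := by
            rcases hfin' j with rfl | rfl | rfl
            · have := hface l 0 (f' false 1) ((c00 l false).trans (by rw [h, hce]))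
              exact ⟨this.2.1 ▸ h, this.1⟩
            · have := hface l 0 (f' false 0) ((c00 false l).symm.trans (by rw [h, hce]))
              exact ⟨this.1, this.2.1 ▸ h⟩
            · have := hface l 1 (f' false 0) ((c01 false l).symm.trans (by rw [h, hce]))
              exact absurd this.2.2 (by decide)
          have h' := hrel (f' false 2)
          rw [c11, c01, key.1, key.2] at h'
          exact hr _ h'
        · have key : f' false 1 = c ∧ f' false 2 = c := by
            rcases hfin' j with rfl | rfl | rfl
            · have := hface l 0 (f' false 2) ((c01 l false).trans (by rw [h, hce]))
              exact absurd this.2.2 (by decide)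
            · have := hface l 1 (f' false 2) ((c11 l false).trans (by rw [h, hce]))
              exact ⟨this.2.1 ▸ h, this.1⟩
            · have := hface l 1 (f' false 1) ((c11 false l).symm.trans (by rw [h, hce]))
              exact ⟨this.1, this.2.1 ▸ h⟩
          have h' := hrel (f' false 0)
          rw [← c00, ← c01, key.1, key.2] at h'
          exact hr _ h'
      | m + 1 => exact fun k i => hcases' m (f' k i)
    choose g' hg' using h1
    simp only [hg'] at hf'
    obtain ⟨x, hx⟩ := hA.fill m g' fun k l i j hij => hinj _ (hf' k l i j hij)
    exact ⟨Sum.inl (Sum.inl x), fun k i => (congrArg _ (congrArg _ (hx k i))).trans (hg' k i).symm⟩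

end Expansion

/-! ### Elementary expansions of transition relations -/

/-- The transition relation `E` on the set of states `T` is the one of a full bideterministic HDA
whose realization is homotopy equivalent to `Z`. -/
def Presents {Ω : Type u} (r : L → L → Prop) (Z : Type*) [TopologicalSpace Z] (T : Set Ω)
    (E : Ω → L → Ω → Prop) : Prop :=
  ∃ (A : HDA.{u} L) (ν : A.cube 0 → Ω), A.IsBideterministic ∧ A.IsFull r ∧
    Function.Injective ν ∧ Set.range ν = T ∧
    (∀ x b y, E x b y ↔ ∃ e, ν (A.face false 0 e) = x ∧ A.label e = b ∧ ν (A.face true 0 e) = y) ∧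
    Nonempty (A.Realization ≃ₕ Z)

variable {Ω : Type u} {r : L → L → Prop} {Z : Type*} [TopologicalSpace Z] {T : Set Ω}
  {E : Ω → L → Ω → Prop}

lemma Presents.expandState (h : Presents r Z T E) (hr : ∀ a, ¬ r a a) {w y : Ω} {z : L}
    (hw : w ∉ T) (hy : y ∈ T) (hz : ∀ x, ¬ E x z y) :
    Presents r Z (insert w T) (fun x c y' => E x c y' ∨ (x = w ∧ c = z ∧ y' = y)) := by
  obtain ⟨A, ν, ⟨hdet, hcodet⟩, hfull, hν, rfl, hE, ⟨φ⟩⟩ := h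
  obtain ⟨y, rfl⟩ := hy
  have hw' : ∀ a, ν a ≠ w := fun a ha => hw ⟨a, ha⟩
  let B := A.expandState y z
  let τ : B.cube 0 → Ω := Sum.elim (Sum.elim ν fun _ => w) fun _ => w
  have hcube : ∀ a : B.cube 0, a = Sum.inl (Sum.inr ⟨rfl⟩) ∨ ∃ a', a = Sum.inl (Sum.inl a') := by
    rintro ((a | _) | ⟨⟨h⟩⟩)
    · exact Or.inr ⟨a, rfl⟩
    · exact Or.inl rfl
    · omega
  refine ⟨B, τ, ⟨?_, ?_⟩, hfull.expandState hr y z, ?_, ?_, ?_, ?_⟩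
  · intro e e' hs hl
    rcases A.expandState_cube_cases y z e with rfl | ⟨e, rfl⟩ <;>
      rcases A.expandState_cube_cases y z e' with rfl | ⟨e', rfl⟩
    · rfl
    · exact (Sum.inr_ne_inl (Sum.inl_injective hs)).elim
    · exact (Sum.inl_ne_inr (Sum.inl_injective hs)).elim
    · exact congrArg _ (congrArg _ (hdet e e' (Sum.inl_injective (Sum.inl_injective hs)) hl))
  · have key : ∀ e : A.cube 1, A.face true 0 e = y → A.label e ≠ z := fun e ht hl =>
      hz _ ((hE _ _ _).2 ⟨e, rfl, hl, congrArg ν ht⟩)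
    intro e e' hs hl
    rcases A.expandState_cube_cases y z e with rfl | ⟨e, rfl⟩ <;>
      rcases A.expandState_cube_cases y z e' with rfl | ⟨e', rfl⟩
    · rfl
    · exact (key e' (Sum.inl_injective (Sum.inl_injective hs)).symm hl.symm).elim
    · exact (key e (Sum.inl_injective (Sum.inl_injective hs)) hl).elim
    · exact congrArg _ (congrArg _ (hcodet e e' (Sum.inl_injective (Sum.inl_injective hs)) hl))
  · intro a a' h
    rcases hcube a with rfl | ⟨a, rfl⟩ <;> rcases hcube a' with rfl | ⟨a', rfl⟩
    · rfl
    · exact (hw' _ h.symm).elim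
    · exact (hw' _ h).elim
    · exact congrArg _ (congrArg _ (hν h))
  · ext x
    constructor
    · rintro ⟨a, rfl⟩
      rcases hcube a with rfl | ⟨a, rfl⟩
      · exact Or.inl rfl
      · exact Or.inr ⟨a, rfl⟩
    · rintro (rfl | ⟨a, rfl⟩)
      · exact ⟨Sum.inl (Sum.inr ⟨rfl⟩), rfl⟩
      · exact ⟨Sum.inl (Sum.inl a), rfl⟩
  · intro x b x'
    refine (or_congr_left (hE _ _ _)).trans ?_
    constructor
    · rintro (⟨e, h⟩ | ⟨rfl, rfl, rfl⟩)
      · exact ⟨Sum.inl (Sum.inl e), h⟩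
      · exact ⟨Sum.inr ⟨rfl⟩, rfl, rfl, rfl⟩
    · rintro ⟨e, h1, h2, h3⟩
      rcases A.expandState_cube_cases y z e with rfl | ⟨e, rfl⟩
      · exact Or.inr ⟨h1.symm, h2.symm, h3.symm⟩
      · exact Or.inl ⟨e, h1, h2, h3⟩
  · obtain ⟨ψ⟩ := A.nonempty_homotopyEquiv_expandState y z
    exact ⟨ψ.trans φ⟩

/-- A new edge with label `b` from `y` to `x` may be added if it completes exactly one square, whose
other sides are `y -a-> p -b-> t` and `x -a-> t`. -/
lemma Presents.attachSquare (h : Presents r Z T E) (hr : IsStrictTotalOrder L r) {a b : L}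
    {x y p t : Ω} (hab : a ≠ b) (h1 : E y a p) (h2 : E p b t) (h3 : E x a t)
    (hsrc : ∀ x', ¬ E y b x') (htgt : ∀ y', ¬ E y' b x)
    (hout : ∀ c y' x', c ≠ b → E y c y' → E x c x' → (E y' b x' ∨ (y' = y ∧ x' = x)) → c = a)
    (hin : ∀ c y' x', c ≠ b → E y' c y → E x' c x → ¬ (E y' b x' ∨ (y' = y ∧ x' = x))) :
    Presents r Z T (fun x₁ c y₁ => E x₁ c y₁ ∨ (x₁ = y ∧ c = b ∧ y₁ = x)) := by
  have hirr : ∀ a, ¬ r a a := fun a => irrefl_of r a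
  obtain ⟨A, ν, ⟨hdet, hcodet⟩, hfull, hν, rfl, hE, ⟨φ⟩⟩ := h
  obtain ⟨e₁, rfl, hl₁, rfl⟩ := (hE _ _ _).1 h1
  obtain ⟨e₃, he₃, hl₃, rfl⟩ := (hE _ _ _).1 h2
  obtain ⟨e₂, rfl, hl₂, he₂⟩ := (hE _ _ _).1 h3
  replace he₃ := hν he₃
  replace he₂ := hν he₂
  clear h1 h2 h3
  generalize hy : A.face false 0 e₁ = y at *
  generalize hx : A.face false 0 e₂ = x at *
  let B := A.attachEdge y x b
  let n : B.cube 1 := A.newEdge y x b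
  have hcases : ∀ e : B.cube 1, e = n ∨ ∃ e', e = Sum.inl e' := by
    rintro (e | _)
    · exact Or.inr ⟨e, rfl⟩
    · exact Or.inl rfl
  have hcube : ∀ a : B.cube 0, ∃ a' : A.cube 0, a = Sum.inl a' := by
    rintro (a | ⟨⟨h⟩⟩)
    · exact ⟨a, rfl⟩
    · omega
  have hBdet : B.IsDeterministic := by
    have key : ∀ e : A.cube 1, A.face false 0 e = y → A.label e ≠ b := fun e hs hl =>
      hsrc _ ((hE _ _ _).2 ⟨e, congrArg ν hs, hl, rfl⟩)
    intro e e' hs hl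
    rcases hcases e with rfl | ⟨e, rfl⟩ <;> rcases hcases e' with rfl | ⟨e', rfl⟩
    · rfl
    · exact (key e' (Sum.inl_injective hs).symm hl.symm).elim
    · exact (key e (Sum.inl_injective hs) hl).elim
    · exact congrArg _ (hdet e e' (Sum.inl_injective hs) hl)
  have hBcodet : B.IsCodeterministic := by
    have key : ∀ e : A.cube 1, A.face true 0 e = x → A.label e ≠ b := fun e hs hl =>
      htgt _ ((hE _ _ _).2 ⟨e, rfl, hl, congrArg ν hs⟩)
    intro e e' hs hl
    rcases hcases e with rfl | ⟨e, rfl⟩ <;> rcases hcases e' with rfl | ⟨e', rfl⟩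
    · rfl
    · exact (key e' (Sum.inl_injective hs).symm hl.symm).elim
    · exact (key e (Sum.inl_injective hs) hl).elim
    · exact congrArg _ (hcodet e e' (Sum.inl_injective hs) hl)
  have hfin : ∀ i : Fin 2, i = 0 ∨ i = 1 := by omega
  -- The direction of the face in which the new edge lies is dictated by the order of the labels.
  obtain ⟨i₀, hi₀⟩ : ∃ i₀ : Fin 2, (i₀ = 0 ∧ r a b) ∨ (i₀ = 1 ∧ r b a) := by
    rcases trichotomous_of r a b with h | h | h
    · exact ⟨0, Or.inl ⟨rfl, h⟩⟩
    · exact (hab h).elim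
    · exact ⟨1, Or.inr ⟨rfl, h⟩⟩
  let g : Bool → Fin 2 → A.cube 1 := fun k i =>
    if i = i₀ then e₃ else bif k then e₂ else e₁
  let f : Bool → Fin 2 → B.cube 1 := fun k i => if i = i₀ ∧ k = false then n else Sum.inl (g k i)
  have hg : ∀ k i, PrecubicalSet.IsBoxFace i₀ k i → f k i = Sum.inl (g k i) := by
    intro k i h
    refine if_neg fun h' => ?_
    rcases h with h | h
    · simp [h] at h'
    · exact h h'.1
  have hfree : f false i₀ = n := if_pos ⟨rfl, rfl⟩
  have hf3 : f true i₀ = Sum.inl e₃ := 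
    (hg _ _ (Or.inl rfl)).trans (congrArg Sum.inl (by simp [g]))
  have hf1 : ∀ i, i ≠ i₀ → f false i = Sum.inl e₁ := fun i h =>
    (hg _ _ (Or.inr h)).trans (congrArg Sum.inl (by simp [g, h]))
  have hf2 : ∀ i, i ≠ i₀ → f true i = Sum.inl e₂ := fun i h =>
    (hg _ _ (Or.inl rfl)).trans (congrArg Sum.inl (by simp [g, h]))
  have hlab : ∀ k, B.label (f k i₀) = b := by
    rintro (_ | _)
    · rw [hfree]; rfl
    · rw [hf3]; exact hl₃
  have hlab' : ∀ k i, i ≠ i₀ → B.label (f k i) = a := by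
    rintro (_ | _) i h
    · rw [hf1 i h]; exact hl₁
    · rw [hf2 i h]; exact hl₂
  have hcompat : ∀ i, i ≠ i₀ → ∀ k l, B.face k 0 (f l i₀) = B.face l 0 (f k i) := by
    rintro i h (_ | _) (_ | _)
    · rw [hfree, hf1 i h]; exact congrArg Sum.inl hy.symm
    · rw [hf3, hf1 i h]; exact congrArg Sum.inl he₃
    · rw [hfree, hf2 i h]; exact congrArg Sum.inl hx.symm
    · rw [hf3, hf2 i h]; exact congrArg Sum.inl he₂.symm
  have hf : ∀ k l, B.face k 0 (f l 1) = B.face l 0 (f k 0) := by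
    intro k l
    rcases hfin i₀ with h | h
    · rw [h] at hcompat; exact (hcompat 1 (by decide) l k).symm
    · rw [h] at hcompat; exact hcompat 0 (by decide) k l
  have hl : ∀ i, B.label (f false i) = B.label (f true i) := by
    intro i
    by_cases h : i = i₀
    · rw [h, hlab, hlab]
    · rw [hlab' _ _ h, hlab' _ _ h]
  have hfr : r (B.label (f false 1)) (B.label (f false 0)) := by
    rcases hi₀ with ⟨rfl, h⟩ | ⟨rfl, h⟩
    · rw [hlab, hlab' _ _ (by decide)]; exact h
    · rw [hlab, hlab' _ _ (by decide)]; exact h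
  have huniq : ∀ f' : Bool → Fin 2 → B.cube 1,
      (∀ k l, B.face k 0 (f' l 1) = B.face l 0 (f' k 0)) →
      (∀ i, B.label (f' false i) = B.label (f' true i)) →
      r (B.label (f' false 1)) (B.label (f' false 0)) → (∃ k i, f' k i = n) → f' = f := by
    rintro f' hf' hl' hr' ⟨k, j, hkj⟩
    obtain ⟨j', hj', hjj', hside⟩ : ∃ j', j' ≠ j ∧ (∀ i, i = j ∨ i = j') ∧
        ∀ k l, B.face k 0 (f' l j) = B.face l 0 (f' k j') := by
      rcases hfin j with rfl | rfl
      · exact ⟨1, by decide, hfin, fun k l => (hf' l k).symm⟩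
      · exact ⟨0, by decide, fun i => (hfin i).symm, hf'⟩
    have hbj : ∀ k, B.label (f' k j) = b := by
      have hb : B.label (f' k j) = b := by rw [hkj]; rfl
      cases k
      · exact Bool.rec hb ((hl' j).symm.trans hb)
      · exact Bool.rec ((hl' j).trans hb) hb
    obtain ⟨c, hc⟩ : ∃ c, ∀ k, B.label (f' k j') = c :=
      ⟨B.label (f' false j'), Bool.rec rfl (hl' j').symm⟩
    have hord : (j = 0 ∧ r c b) ∨ (j = 1 ∧ r b c) := by
      rcases hfin j with rfl | rfl
      · obtain rfl : j' = 1 := (hfin j').resolve_left hj'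
        rw [hc, hbj] at hr'
        exact Or.inl ⟨rfl, hr'⟩
      · obtain rfl : j' = 0 := (hfin j').resolve_right hj'
        rw [hc, hbj] at hr'
        exact Or.inr ⟨rfl, hr'⟩
    have hcb : c ≠ b := by
      rintro rfl
      rcases hord with h | h <;> exact hirr _ h.2
    have hold : ∀ k, ∃ e, f' k j' = Sum.inl e := fun k =>
      (hcases _).resolve_left fun h => hcb (by rw [← hc k, h]; rfl)
    choose d hd using hold
    have hdl : ∀ k, A.label (d k) = c := fun k => by
      have := hc k
      rwa [hd] at this
    have hBb : ∀ (e : B.cube 1) (s t : A.cube 0), B.label e = b → B.face false 0 e = Sum.inl s →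
        B.face true 0 e = Sum.inl t → E (ν s) b (ν t) ∨ (ν s = ν y ∧ ν t = ν x) := by
      intro e s t h hs ht
      rcases hcases e with rfl | ⟨e, rfl⟩
      · exact Or.inr ⟨congrArg ν (Sum.inl_injective hs).symm,
          congrArg ν (Sum.inl_injective ht).symm⟩
      · exact Or.inl ((hE _ _ _).2 ⟨e, congrArg ν (Sum.inl_injective hs), h,
          congrArg ν (Sum.inl_injective ht)⟩)
    have hEd : ∀ k, E (ν (A.face false 0 (d k))) c (ν (A.face true 0 (d k))) := fun k =>
      (hE _ _ _).2 ⟨d k, rfl, hdl k, rfl⟩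
    have hsd : ∀ k l, B.face k 0 (f' l j) = Sum.inl (A.face l 0 (d k)) := fun k l => by
      rw [hside, hd]; rfl
    cases k
    · have hs0 : A.face false 0 (d false) = y :=
        (Sum.inl_injective ((congrArg (B.face false 0) hkj).symm.trans (hsd false false))).symm
      have hs1 : A.face false 0 (d true) = x :=
        (Sum.inl_injective ((congrArg (B.face true 0) hkj).symm.trans (hsd true false))).symm
      have hca : c = a := hout c _ _ hcb (hs0 ▸ hEd false) (hs1 ▸ hEd true)
        (hBb (f' true j) _ _ (hbj true) (hsd false true) (hsd true true))
      subst hca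
      have hd0 : d false = e₁ := hdet _ _ (hs0.trans hy.symm) ((hdl _).trans hl₁.symm)
      have hd1 : d true = e₂ := hdet _ _ (hs1.trans hx.symm) ((hdl _).trans hl₂.symm)
      have h3 : f' true j = Sum.inl e₃ := by
        refine hBdet _ _ ?_ ((hbj true).trans hl₃.symm)
        rw [hsd, hd0, ← he₃]
        rfl
      have hji : j = i₀ := by
        rcases hord with h | h <;> rcases hi₀ with h' | h'
        · exact h.1.trans h'.1.symm
        · exact (asymm_of r h.2 h'.2).elim
        · exact (asymm_of r h.2 h'.2).elim
        · exact h.1.trans h'.1.symm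
      subst hji
      funext k i
      rcases hjj' i with rfl | rfl <;> cases k
      · rw [hkj, hfree]
      · rw [h3, hf3]
      · rw [hd, hd0, hf1 i hj']
      · rw [hd, hd1, hf2 i hj']
    · have hs0 : A.face true 0 (d false) = y :=
        (Sum.inl_injective ((congrArg (B.face false 0) hkj).symm.trans (hsd false true))).symm
      have hs1 : A.face true 0 (d true) = x :=
        (Sum.inl_injective ((congrArg (B.face true 0) hkj).symm.trans (hsd true true))).symm
      exact (hin c _ _ hcb (hs0 ▸ hEd false) (hs1 ▸ hEd true)
        (hBb (f' false j) _ _ (hbj false) (hsd false false) (hsd true false))).elim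
  let C := B.attachSquare f hf hl
  have hC0 : ∀ s : C.cube 0, ∃ s' : A.cube 0, s = Sum.inl (Sum.inl s') := by
    rintro (s | ⟨⟨h⟩⟩)
    · obtain ⟨s, rfl⟩ := hcube s
      exact ⟨s, rfl⟩
    · omega
  have hC1 : ∀ e : C.cube 1, ∃ e' : B.cube 1, e = Sum.inl e' := by
    rintro (e | ⟨⟨h⟩⟩)
    · exact ⟨e, rfl⟩
    · omega
  let τ : C.cube 0 → Ω := Sum.elim (Sum.elim ν fun _ => ν y) fun _ => ν y
  refine ⟨C, τ,
    ⟨?_, ?_⟩, hfull.attachSquare hirr hfree hg hfr huniq, ?_, ?_, ?_, ?_⟩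
  · intro e e' hs hl
    obtain ⟨e, rfl⟩ := hC1 e
    obtain ⟨e', rfl⟩ := hC1 e'
    exact congrArg _ (hBdet e e' (Sum.inl_injective hs) hl)
  · intro e e' hs hl
    obtain ⟨e, rfl⟩ := hC1 e
    obtain ⟨e', rfl⟩ := hC1 e'
    exact congrArg _ (hBcodet e e' (Sum.inl_injective hs) hl)
  · intro s s' h
    obtain ⟨s, rfl⟩ := hC0 s
    obtain ⟨s', rfl⟩ := hC0 s'
    exact congrArg _ (congrArg _ (hν h))
  · ext s
    constructor
    · rintro ⟨s, rfl⟩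
      obtain ⟨s, rfl⟩ := hC0 s
      exact ⟨s, rfl⟩
    · rintro ⟨s, rfl⟩
      exact ⟨Sum.inl (Sum.inl s), rfl⟩
  · intro x₁ c y₁
    refine (or_congr_left (hE _ _ _)).trans ?_
    constructor
    · rintro (⟨e, h⟩ | ⟨rfl, rfl, rfl⟩)
      · exact ⟨Sum.inl (Sum.inl e), h⟩
      · exact ⟨Sum.inl n, rfl, rfl, rfl⟩
    · rintro ⟨e, h1, h2, h3⟩
      obtain ⟨e, rfl⟩ := hC1 e
      rcases hcases e with rfl | ⟨e, rfl⟩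
      · exact Or.inr ⟨h1.symm, h2.symm, h3.symm⟩
      · exact Or.inl ⟨e, h1, h2, h3⟩
  · obtain ⟨ψ⟩ := nonempty_homotopyEquiv_attachSquare (hf := hf) (hl := hl) hfree hg
    exact ⟨ψ.trans φ⟩

end HDA

namespace HDA

/-! ### The ladder of a zigzag -/

/-- A zigzag in a bideterministic transition relation `E`: a path without repetitions
`v 0 → ⋯ → v k` with labels `b 0, …, b (k - 1)`, followed by an edge with label `a` from a state
`u`, which is not the end of an edge starting on the path, to the end of the path. -/
structure Zigzag (S : Type u) (L : Type v) where
  E : S → L → S → Prop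
  det : ∀ x c y y', E x c y → E x c y' → y = y'
  codet : ∀ x x' c y, E x c y → E x' c y → x = x'
  k : ℕ
  v : ℕ → S
  b : ℕ → L
  path : ∀ l < k, E (v l) (b l) (v (l + 1))
  injective : ∀ l ≤ k, ∀ l' ≤ k, v l = v l' → l = l'
  u : S
  a : L
  edge : E u a (v k)
  not_edge : ∀ l ≤ k, ∀ c, ¬ E (v l) c u
  ne : ∀ l ≤ k, v l ≠ u

namespace Zigzag

variable {S : Type u} {L : Type v}

/-- The states of a transition relation together with two rows of new states. -/
abbrev State (S : Type u) : Type u := S ⊕ (ℕ ⊕ ℕ)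

/-- The `l`-th state of the copy of the path. -/
abbrev copy (l : ℕ) : State S := Sum.inr (Sum.inl l)

/-- The `l`-th state of the row parallel to the copy of the path. -/
abbrev shift (l : ℕ) : State S := Sum.inr (Sum.inr l)

/-- The labels of a transition relation together with a new one. -/
abbrev Label (L : Type v) : Type v := L ⊕ PUnit.{v + 1}

/-- The new label, carried by the edges from the copy of the zigzag to the zigzag itself. -/
abbrev fresh : Label L := Sum.inr PUnit.unit

variable (D : Zigzag S L)

/-- The transition relation `E` together with a copy of the part of the path from the position `i`
on, and the ladder that transports the edge from `u` to the end of the path back along the copy to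
the position `j`. The last state of the second row is the copy of `u`. -/
inductive Ladder (i j : ℕ) : State S → Label L → State S → Prop
  | old {x c y} : D.E x c y → Ladder i j (Sum.inl x) (Sum.inl c) (Sum.inl y)
  | down {l} : i ≤ l → l ≤ D.k → Ladder i j (copy l) fresh (Sum.inl (D.v l))
  | chain {l} : i ≤ l → l < D.k → Ladder i j (copy l) (Sum.inl (D.b l)) (copy (l + 1))
  | exit : j ≤ D.k → Ladder i j (shift D.k) fresh (Sum.inl D.u)
  | rung {l} : j ≤ l → l ≤ D.k → Ladder i j (shift l) (Sum.inl D.a) (copy l)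
  | rail {l} : j ≤ l → l < D.k → Ladder i j (shift l) (Sum.inl (D.b l)) (shift (l + 1))

/-- The states of `Ladder i j`. -/
def ladderStates (i j : ℕ) : Set (State S) :=
  {x | ∀ l, (x = copy l → i ≤ l ∧ l ≤ D.k) ∧ (x = shift l → j ≤ l ∧ l ≤ D.k)}

variable {D} {r : Label L → Label L → Prop} {Z : Type*} [TopologicalSpace Z]

lemma presents_chain_last (hr : IsStrictTotalOrder (Label L) r)
    (h : Presents r Z (D.ladderStates (D.k + 1) (D.k + 1)) (D.Ladder (D.k + 1) (D.k + 1))) :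
    Presents r Z (D.ladderStates D.k (D.k + 1)) (D.Ladder D.k (D.k + 1)) := by
  have := h.expandState (irrefl_of r) (w := copy D.k) (y := Sum.inl (D.v D.k)) (z := fresh)
    (by simp [ladderStates]) (by simp [ladderStates]) (by
      intro x h
      generalize hy : (Sum.inl (D.v D.k) : State S) = y at h
      cases h <;> omega)
  convert this using 1
  · ext x
    rcases x with x | l | l <;> simp [ladderStates]
    all_goals omega
  · funext x c y
    refine propext ⟨fun h => ?_, ?_⟩
    · cases h with
      | old h => exact Or.inl (.old h)
      | @down l h h' =>
        obtain rfl := le_antisymm h h'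
        exact Or.inr ⟨rfl, rfl, rfl⟩
      | _ => omega
    · rintro (h | ⟨rfl, rfl, rfl⟩)
      · cases h with
        | old h => exact .old h
        | _ => omega
      · exact .down le_rfl le_rfl

lemma presents_chain_step (hr : IsStrictTotalOrder (Label L) r) {i : ℕ} (hi : i < D.k)
    (h : Presents r Z (D.ladderStates (i + 1) (D.k + 1)) (D.Ladder (i + 1) (D.k + 1))) :
    Presents r Z (D.ladderStates i (D.k + 1)) (D.Ladder i (D.k + 1)) := by
  have hout : ∀ c x', ¬ D.Ladder (i + 1) (D.k + 1) (copy i) c x' := by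
    intro c x' h
    cases h
    all_goals omega
  have h1 := h.expandState (irrefl_of r) (w := copy i) (y := Sum.inl (D.v i)) (z := fresh)
    (by simp [ladderStates]) (by simp [ladderStates]) (by
      intro x h
      generalize hy : (Sum.inl (D.v i) : State S) = y at h
      cases h with
      | @down l h h' => have := D.injective i hi.le l h' (Sum.inl_injective hy); omega
      | exit h => omega)
  have h2 := h1.attachSquare hr (a := fresh) (b := Sum.inl (D.b i)) (x := copy (i + 1))
    (y := copy i) (p := Sum.inl (D.v i)) (t := Sum.inl (D.v (i + 1))) (by simp)
    (Or.inr ⟨rfl, rfl, rfl⟩) (Or.inl (.old (D.path i hi))) (Or.inl (.down le_rfl hi))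
    (by
      rintro x' (h | ⟨-, h, -⟩)
      · exact hout _ _ h
      · simp at h)
    (by
      rintro y' (h | ⟨-, h, -⟩)
      · generalize hy : (copy (i + 1) : State S) = y at h
        generalize hc : (Sum.inl (D.b i) : Label L) = c at h
        cases h <;> simp at hy hc <;> omega
      · simp at h)
    (by
      rintro c y' x' hc (h | ⟨-, h, -⟩) - -
      · exact (hout _ _ h).elim
      · exact h)
    (by
      rintro c y' x' hc (h | ⟨-, -, h⟩)
      · generalize hy : (copy i : State S) = y at h
        cases h <;> simp at hy <;> omega
      · simp at h)
  convert h2 using 1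
  · ext x
    rcases x with x | l | l <;> simp [ladderStates]
    all_goals omega
  · funext x c y
    refine propext ⟨fun h => ?_, ?_⟩
    · cases h with
      | old h => exact Or.inl (Or.inl (.old h))
      | @down l h h' =>
        rcases h.eq_or_lt with rfl | h
        · exact Or.inl (Or.inr ⟨rfl, rfl, rfl⟩)
        · exact Or.inl (Or.inl (.down h h'))
      | @chain l h h' =>
        rcases h.eq_or_lt with rfl | h
        · exact Or.inr ⟨rfl, rfl, rfl⟩
        · exact Or.inl (Or.inl (.chain h h'))
      | _ => omega
    · rintro ((h | ⟨rfl, rfl, rfl⟩) | ⟨rfl, rfl, rfl⟩)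
      · cases h with
        | old h => exact .old h
        | down h h' => exact .down (by omega) h'
        | chain h h' => exact .chain (by omega) h'
        | _ => omega
      · exact .down le_rfl hi.le
      · exact .chain le_rfl hi

lemma presents_rung_last (hr : IsStrictTotalOrder (Label L) r)
    (h : Presents r Z (D.ladderStates 0 (D.k + 1)) (D.Ladder 0 (D.k + 1))) :
    Presents r Z (D.ladderStates 0 D.k) (D.Ladder 0 D.k) := by
  have hout : ∀ c x', ¬ D.Ladder 0 (D.k + 1) (shift D.k) c x' := by
    intro c x' h
    cases h
    all_goals omega
  have hin : ∀ c x', ¬ D.Ladder 0 (D.k + 1) x' c (shift D.k) := by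
    intro c x' h
    generalize hy : (shift D.k : State S) = y at h
    cases h <;> simp at hy
    omega
  have h1 := h.expandState (irrefl_of r) (w := shift D.k) (y := Sum.inl D.u) (z := fresh)
    (by simp [ladderStates]) (by simp [ladderStates]) (by
      intro x h
      generalize hy : (Sum.inl D.u : State S) = y at h
      cases h with
      | @down l h h' => exact D.ne l h' (Sum.inl_injective hy).symm
      | exit h => omega)
  have h2 := h1.attachSquare hr (a := fresh) (b := Sum.inl D.a) (x := copy D.k)
    (y := shift D.k) (p := Sum.inl D.u) (t := Sum.inl (D.v D.k)) (by simp)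
    (Or.inr ⟨rfl, rfl, rfl⟩) (Or.inl (.old D.edge)) (Or.inl (.down (Nat.zero_le _) le_rfl))
    (by
      rintro x' (h | ⟨-, h, -⟩)
      · exact hout _ _ h
      · simp at h)
    (by
      rintro y' (h | ⟨-, h, -⟩)
      · generalize hy : (copy D.k : State S) = y at h
        generalize hc : (Sum.inl D.a : Label L) = c at h
        cases h with
        | @chain l _ hl =>
          -- The states `u` and `v (k - 1)` differ, so the edges from them to `v k` do, too.
          have hl' : l + 1 = D.k := by simpa using hy.symm
          have := D.path l hl
          rw [← Sum.inl_injective hc, hl'] at this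
          exact D.ne l hl.le (D.codet _ _ _ _ this D.edge)
        | rung => omega
        | _ => simp at hy
      · simp at h)
    (by
      rintro c y' x' hc (h | ⟨-, h, -⟩) - -
      · exact (hout _ _ h).elim
      · exact h)
    (by
      rintro c y' x' hc (h | ⟨-, -, h⟩)
      · exact (hin _ _ h).elim
      · simp at h)
  convert h2 using 1
  · ext x
    rcases x with x | l | l <;> simp [ladderStates]
    all_goals omega
  · funext x c y
    refine propext ⟨fun h => ?_, ?_⟩
    · cases h with
      | old h => exact Or.inl (Or.inl (.old h))
      | down h h' => exact Or.inl (Or.inl (.down h h'))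
      | chain h h' => exact Or.inl (Or.inl (.chain h h'))
      | exit h => exact Or.inl (Or.inr ⟨rfl, rfl, rfl⟩)
      | @rung l h h' =>
        obtain rfl := le_antisymm h h'
        exact Or.inr ⟨rfl, rfl, rfl⟩
      | _ => omega
    · rintro ((h | ⟨rfl, rfl, rfl⟩) | ⟨rfl, rfl, rfl⟩)
      · cases h with
        | old h => exact .old h
        | down h h' => exact .down h h'
        | chain h h' => exact .chain h h'
        | _ => omega
      · exact .exit le_rfl
      · exact .rung le_rfl le_rfl

lemma presents_rung_step (hr : IsStrictTotalOrder (Label L) r) {j : ℕ} (hj : j < D.k)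
    (hb : ∀ m < D.k, j ≤ m + 1 → D.b m ≠ D.a)
    (h : Presents r Z (D.ladderStates 0 (j + 1)) (D.Ladder 0 (j + 1))) :
    Presents r Z (D.ladderStates 0 j) (D.Ladder 0 j) := by
  have hout : ∀ c x', ¬ D.Ladder 0 (j + 1) (shift j) c x' := by
    intro c x' h
    generalize hx : (shift j : State S) = x at h
    cases h <;> simp at hx <;> omega
  have hin : ∀ c x' m, m ≤ j + 1 → ¬ D.Ladder 0 (j + 1) x' c (shift m) := by
    intro c x' m hm h
    generalize hy : (shift m : State S) = y at h
    cases h <;> simp at hy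
    omega
  have h1 := h.expandState (irrefl_of r) (w := shift j) (y := copy j) (z := Sum.inl D.a)
    (by simp [ladderStates]) (by simp [ladderStates]; omega) (by
      intro x h
      generalize hy : (copy j : State S) = y at h
      generalize hc : (Sum.inl D.a : Label L) = c at h
      cases h with
      | @chain l _ hl =>
        have hl' : j = l + 1 := by simpa using hy
        exact hb l hl hl'.le (Sum.inl_injective hc).symm
      | rung h =>
        have := Sum.inl_injective (Sum.inr_injective hy)
        omega
      | _ => simp at hy)
  have h2 := h1.attachSquare hr (a := Sum.inl D.a) (b := Sum.inl (D.b j)) (x := shift (j + 1))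
    (y := shift j) (p := copy j) (t := copy (j + 1))
    (fun h => hb j hj (Nat.le_succ j) (Sum.inl_injective h).symm)
    (Or.inr ⟨rfl, rfl, rfl⟩) (Or.inl (.chain (Nat.zero_le _) hj)) (Or.inl (.rung le_rfl hj))
    (by
      rintro x' (h | ⟨-, h, -⟩)
      · exact hout _ _ h
      · exact hb j hj (Nat.le_succ j) (Sum.inl_injective h))
    (by
      rintro y' (h | ⟨-, h, -⟩)
      · exact hin _ _ _ le_rfl h
      · exact hb j hj (Nat.le_succ j) (Sum.inl_injective h))
    (by
      rintro c y' x' hc (h | ⟨-, h, -⟩) - -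
      · exact (hout _ _ h).elim
      · exact h)
    (by
      rintro c y' x' hc (h | ⟨-, -, h⟩)
      · exact (hin _ _ _ (Nat.le_succ j) h).elim
      · simp at h)
  convert h2 using 1
  · ext x
    rcases x with x | l | l <;> simp [ladderStates]
    all_goals omega
  · funext x c y
    refine propext ⟨fun h => ?_, ?_⟩
    · cases h with
      | old h => exact Or.inl (Or.inl (.old h))
      | down h h' => exact Or.inl (Or.inl (.down h h'))
      | chain h h' => exact Or.inl (Or.inl (.chain h h'))
      | exit h => exact Or.inl (Or.inl (.exit hj))
      | @rung l h h' =>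
        rcases h.eq_or_lt with rfl | h
        · exact Or.inl (Or.inr ⟨rfl, rfl, rfl⟩)
        · exact Or.inl (Or.inl (.rung h h'))
      | @rail l h h' =>
        rcases h.eq_or_lt with rfl | h
        · exact Or.inr ⟨rfl, rfl, rfl⟩
        · exact Or.inl (Or.inl (.rail h h'))
    · rintro ((h | ⟨rfl, rfl, rfl⟩) | ⟨rfl, rfl, rfl⟩)
      · cases h with
        | old h => exact .old h
        | down h h' => exact .down h h'
        | chain h h' => exact .chain h h'
        | exit h => exact .exit hj.le
        | rung h h' => exact .rung (by omega) h'
        | rail h h' => exact .rail (by omega) h'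
      · exact .rung le_rfl hj.le
      · exact .rail le_rfl hj

/-- The ladder can be built down to the position `j` if the label `a` does not occur on the path
from the position `j - 1` on. -/
lemma presents_ladder (hr : IsStrictTotalOrder (Label L) r)
    (h : Presents r Z (D.ladderStates (D.k + 1) (D.k + 1)) (D.Ladder (D.k + 1) (D.k + 1)))
    {j : ℕ} (hj : j ≤ D.k) (hb : ∀ m < D.k, j ≤ m + 1 → D.b m ≠ D.a) :
    Presents r Z (D.ladderStates 0 j) (D.Ladder 0 j) := by
  have hchain : Presents r Z (D.ladderStates 0 (D.k + 1)) (D.Ladder 0 (D.k + 1)) :=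
    Nat.decreasingInduction
      (motive := fun i _ => Presents r Z (D.ladderStates i (D.k + 1)) (D.Ladder i (D.k + 1)))
      (fun i hi h => presents_chain_step hr hi h) (presents_chain_last hr h) (Nat.zero_le D.k)
  induction hj using Nat.decreasingInduction with
  | self => exact presents_rung_last hr hchain
  | of_succ j hj ih =>
    exact presents_rung_step hr hj hb (ih fun m hm hjm => hb m hm (by omega))

/-- If the path has an edge with label `a` at the position `j`, then this edge takes the place of
the next rung of the ladder. -/
lemma presents_closed_ladder (hr : IsStrictTotalOrder (Label L) r) {j : ℕ} (hj : j + 1 < D.k)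
    (hbj : D.b j = D.a) (hbj' : D.b (j + 1) ≠ D.a)
    (h : Presents r Z (D.ladderStates 0 (j + 2)) (D.Ladder 0 (j + 2))) :
    Presents r Z (D.ladderStates 0 (j + 2)) (fun x c y => D.Ladder 0 (j + 2) x c y ∨
      (x = copy j ∧ c = Sum.inl (D.b (j + 1)) ∧ y = shift (j + 2))) := by
  have hin : ∀ c x', ¬ D.Ladder 0 (j + 2) x' c (shift (j + 2)) := by
    intro c x' h
    generalize hy : (shift (j + 2) : State S) = y at h
    cases h <;> simp at hy
    omega
  refine h.attachSquare hr (a := Sum.inl D.a) (p := copy (j + 1)) (t := copy (j + 2))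
    (fun h => hbj' (Sum.inl_injective h).symm) ?_ (.chain (Nat.zero_le _) hj)
    (.rung le_rfl hj) ?_ (fun y' => hin _ _) ?_ (fun c y' x' _ _ h => (hin _ _ h).elim)
  · rw [← hbj]
    exact .chain (Nat.zero_le _) (by omega)
  · intro x' h
    generalize hx : (copy j : State S) = x at h
    generalize hc : (Sum.inl (D.b (j + 1)) : Label L) = c at h
    cases h with
    | @chain l _ hl =>
      obtain rfl : j = l := by simpa using hx
      exact hbj' ((Sum.inl_injective hc).trans hbj)
    | _ => simp at hx hc
  · intro c y' x' hc h h' h''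
    generalize hx : (copy j : State S) = x at h
    cases h with
    | @chain l _ hl =>
      obtain rfl : j = l := by simpa using hx
      rw [hbj]
    | @down l _ hl =>
      -- A second square would contain an edge from the path to `u`.
      exfalso
      obtain rfl : j = l := by simpa using hx
      generalize hq : (shift (j + 2) : State S) = q at h'
      generalize hf : (fresh : Label L) = f at h'
      cases h' with
      | exit =>
        rcases h'' with h'' | ⟨h'', -⟩
        · generalize hs : (Sum.inl (D.v j) : State S) = s at h''
          generalize ht : (Sum.inl D.u : State S) = t at h''
          generalize (Sum.inl (D.b (j + 1)) : Label L) = d at h''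
          cases h'' with
          | old h'' =>
            rw [← Sum.inl_injective hs, ← Sum.inl_injective ht] at h''
            exact D.not_edge j hl _ h''
          | _ => simp at hs ht
        · simp at h''
      | _ => simp at hq hf
    | _ => simp at hx

end Zigzag

end HDA

/-! ### Connectedness and paths -/

namespace PrecubicalSet

variable {X : PrecubicalSet.{u}}

/-- The source corner of a cube. -/
def corner : ∀ {n : ℕ}, X.cube n → X.cube 0
  | 0, x => x
  | _ + 1, x => corner (X.face false 0 x)

lemma corner_face {P : X.cube 0 → Prop}
    (hP : ∀ e : X.cube 1, P (X.face false 0 e) ↔ P (X.face true 0 e)) :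
    ∀ {n : ℕ} (k : Bool) (i : Fin (n + 1)) (x : X.cube (n + 1)),
      P (corner (X.face k i x)) ↔ P (corner x)
  | 0, k, i, x => by
    obtain rfl : i = 0 := Fin.fin_one_eq_zero i
    cases k
    · rfl
    · exact (hP x).symm
  | n + 1, k, i, x => by
    -- Faces in different directions have a common face.
    have key : ∀ (k l : Bool) (i j : Fin (n + 1)), i ≤ j →
        (P (corner (X.face l j.succ x)) ↔ P (corner (X.face k i.castSucc x))) := by
      intro k l i j hij
      rw [← corner_face hP k i (X.face l j.succ x), X.face_face k l i j hij,
        corner_face hP l j]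
    have h0 : ∀ k l, P (corner (X.face l 1 x)) ↔ P (corner (X.face k 0 x)) := fun k l =>
      key k l 0 0 le_rfl
    change _ ↔ P (corner (X.face false 0 x))
    induction i using Fin.cases with
    | zero => exact (h0 k false).symm.trans (h0 false false)
    | succ i => exact key false k 0 i (Fin.zero_le i)

/-- In a connected precubical set, a property of the vertices that is invariant along the edges is
constant. -/
lemma iff_of_connected [PreconnectedSpace X.Realization] {P : X.cube 0 → Prop}
    (hP : ∀ e : X.cube 1, P (X.face false 0 e) ↔ P (X.face true 0 e)) (x y : X.cube 0) :
    P x ↔ P y := by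
  classical
  let f : X.Realization → Bool := Quot.lift (fun p => decide (P (corner p.1.2))) (by
    rintro _ _ ⟨k, i, x, t⟩
    exact decide_eq_decide.2 (corner_face hP k i x))
  have hf : Continuous f :=
    continuous_quot_lift _ (continuous_sigma fun c =>
      (continuous_const : Continuous fun _ : Fin c.1 → I => decide (P (corner c.2))))
  have h := PreconnectedSpace.constant ‹_› hf (x := pt x Fin.elim0) (y := pt y Fin.elim0)
  exact decide_eq_decide.1 h

end PrecubicalSet

lemma ContinuousMap.HomotopyEquiv.pathConnectedSpace {X Y : Type*} [TopologicalSpace X]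
    [TopologicalSpace Y] [PathConnectedSpace X] (φ : X ≃ₕ Y) : PathConnectedSpace Y := by
  obtain ⟨H⟩ := φ.right_inv
  have h : ∀ y, Joined (φ (φ.invFun y)) y := fun y =>
    ⟨⟨⟨fun t => H (t, y), by fun_prop⟩, by simp, by simp⟩⟩
  obtain ⟨x₀⟩ := PathConnectedSpace.nonempty (X := X)
  refine ⟨⟨φ x₀⟩, fun y y' => ?_⟩
  refine (h y).symm.trans (Joined.trans ?_ (h y'))
  exact (PathConnectedSpace.joined _ _).map φ.toFun.continuous

/-- A shortest path has no repetitions. -/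
lemma Relation.ReflTransGen.exists_injective_path {S : Type*} {R : S → S → Prop} {x y : S}
    (h : Relation.ReflTransGen R x y) : ∃ (k : ℕ) (v : ℕ → S), v 0 = x ∧ v k = y ∧
      (∀ l < k, R (v l) (v (l + 1))) ∧ ∀ l ≤ k, ∀ l' ≤ k, v l = v l' → l = l' := by
  classical
  have hex : ∃ k, ∃ v : ℕ → S, v 0 = x ∧ v k = y ∧ ∀ l < k, R (v l) (v (l + 1)) := by
    induction h with
    | refl => exact ⟨0, fun _ => x, rfl, rfl, by simp⟩
    | @tail y z _ hyz ih =>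
      obtain ⟨k, v, h0, hk, hv⟩ := ih
      refine ⟨k + 1, fun l => if l ≤ k then v l else z, by simp [h0], by simp, fun l hl => ?_⟩
      rcases (Nat.lt_succ_iff.1 hl).lt_or_eq with h | rfl
      · simpa [h.le, Nat.succ_le_iff.2 h] using hv l h
      · simpa [hk] using hyz
  obtain ⟨v, h0, hk, hv⟩ := Nat.find_spec hex
  refine ⟨Nat.find hex, v, h0, hk, hv, ?_⟩
  have key : ∀ l l', l < l' → l' ≤ Nat.find hex → v l ≠ v l' := by
    intro l l' hll hl' heq
    -- Otherwise, cut out the part of the path between the positions `l` and `l'`.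
    refine Nat.find_min hex (m := Nat.find hex - (l' - l)) (by omega)
      ⟨fun m => if m ≤ l then v m else v (m + (l' - l)), by simp [h0], ?_, fun m hm => ?_⟩
    · by_cases h : Nat.find hex - (l' - l) ≤ l
      · have h1 : Nat.find hex - (l' - l) = l := by omega
        have h2 : Nat.find hex = l' := by omega
        simp only [h1, le_refl, if_true]
        rw [heq, ← h2, hk]
      · simp only [h, if_false]
        rw [Nat.sub_add_cancel (by omega), hk]
    · rcases lt_trichotomy m l with h | rfl | h
      · simpa [h.le, Nat.succ_le_iff.2 h] using hv m (by omega)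
      · have := hv l' (by omega)
        simpa [heq, show m + 1 + (l' - m) = l' + 1 by omega] using this
      · simpa [h.not_ge, (show ¬ m + 1 ≤ l by omega), add_right_comm] using
          hv (m + (l' - l)) (by omega)
  intro l hl l' hl' h
  rcases lt_trichotomy l l' with h' | h' | h'
  · exact (key l l' h' hl' h).elim
  · exact h'
  · exact (key l' l h' hl h.symm).elim

namespace HDA

variable {L : Type v}

lemma exists_edge_of_not_reachable {A : HDA.{u} L} (hA : A.IsConnected)
    {s : A.cube 0} (hs : ¬ A.Reachable s) :
    ∃ e, ¬ A.Reachable (A.face false 0 e) ∧ A.Reachable (A.face true 0 e) := by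
  by_contra! h
  have : PathConnectedSpace A.Realization := hA
  refine hs ((PrecubicalSet.iff_of_connected (X := A.toPrecubicalSet) (P := A.Reachable)
    (fun e => ⟨fun h' => h'.tail ⟨e, rfl, rfl⟩, fun h' => ?_⟩) A.init s).1 .refl)
  by_contra h''
  exact h e h'' h'

/-! ### Making one more state reachable -/

/-- The HDA obtained by renaming the labels. -/
def relabel {M : Type*} [Finite M] (A : HDA.{u} L) (g : L → M) : HDA.{u} M where
  toPrecubicalSet := A.toPrecubicalSet
  init := A.init
  finite_labels := ‹_›
  label e := g (A.label e)
  label_face x i := congrArg g (A.label_face x i)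

lemma IsBideterministic.relabel {M : Type*} [Finite M] {A : HDA.{u} L} {g : L → M}
    (hg : Function.Injective g) (hA : A.IsBideterministic) : (A.relabel g).IsBideterministic :=
  ⟨fun e e' h hl => hA.1 e e' h (hg hl), fun e e' h hl => hA.2 e e' h (hg hl)⟩

lemma IsFull.relabel {M : Type*} [Finite M] {A : HDA.{u} L} {g : L → M}
    {r : L → L → Prop} {r' : M → M → Prop} (hg : Function.Injective g)
    (hr : ∀ a b, r' (g a) (g b) ↔ r a b) (hA : A.IsFull r) : (A.relabel g).IsFull r' where
  rel x := (hr _ _).2 (hA.rel x)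
  eq_of_face := hA.eq_of_face
  fill_two f hf hl hf' := hA.fill_two f hf (fun i => hg (hl i)) ((hr _ _).1 hf')
  fill := hA.fill

/-- The HDA obtained by changing the initial state. -/
def withInit (A : HDA.{u} L) (s : A.cube 0) : HDA.{u} L :=
  { A with init := s }

lemma IsFull.withInit {A : HDA.{u} L} {r : L → L → Prop} (hA : A.IsFull r) (s : A.cube 0) :
    (A.withInit s).IsFull r where
  rel := hA.rel
  eq_of_face := hA.eq_of_face
  fill_two := hA.fill_two
  fill := hA.fill

/-- Reachability for a labelled transition relation. -/
abbrev Leads {Ω : Type*} (E : Ω → L → Ω → Prop) : Ω → Ω → Prop :=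
  Relation.ReflTransGen fun x y => ∃ c, E x c y

lemma Presents.exists_hda {Ω : Type u} {r : L → L → Prop} {Z : Type*} [TopologicalSpace Z]
    {T : Set Ω} {E : Ω → L → Ω → Prop} (h : Presents r Z T E) {x₀ : Ω} (hx₀ : x₀ ∈ T) :
    ∃ B : HDA.{u} L, B.IsBideterministic ∧ B.IsFull r ∧ Nonempty (B.Realization ≃ₕ Z) ∧
      ∃ ν : B.cube 0 → Ω, Function.Injective ν ∧ (∀ s, ν s ∈ T) ∧
        ∀ s, Leads E x₀ (ν s) → B.Reachable s := by
  obtain ⟨A, ν, hbi, hfull, hν, rfl, hE, hZ⟩ := h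
  obtain ⟨s₀, rfl⟩ := hx₀
  refine ⟨A.withInit s₀, hbi, hfull.withInit s₀, hZ, ν, hν, fun s => ⟨s, rfl⟩, ?_⟩
  have key : ∀ y, Leads E (ν s₀) y → ∃ s, ν s = y ∧ (A.withInit s₀).Reachable s := by
    intro y hy
    induction hy with
    | refl => exact ⟨s₀, rfl, .refl⟩
    | tail _ hyz ih =>
      obtain ⟨s, rfl, hs⟩ := ih
      obtain ⟨c, hc⟩ := hyz
      obtain ⟨e, he, -, rfl⟩ := (hE _ _ _).1 hc
      exact ⟨_, rfl, hs.tail ⟨e, hν he, rfl⟩⟩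
  intro s hs
  obtain ⟨s', hs', h⟩ := key _ hs
  exact hν hs' ▸ h

namespace Zigzag

variable {S : Type u} {D : Zigzag S L}

/-- The ladder, closed if necessary, leads from one of its states to all new states, to the start of
the path, and to `u`. -/
lemma exists_presents {r : Label L → Label L → Prop} {Z : Type*} [TopologicalSpace Z]
    (hr : IsStrictTotalOrder (Label L) r)
    (h : Presents r Z (D.ladderStates (D.k + 1) (D.k + 1)) (D.Ladder (D.k + 1) (D.k + 1))) :
    ∃ (T : Set (State S)) (E : State S → Label L → State S → Prop) (x₀ : State S),
      Presents r Z T E ∧ x₀ ∈ T ∧ (∀ x c y, D.E x c y → E (Sum.inl x) (Sum.inl c) (Sum.inl y)) ∧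
      (∀ x, Sum.inr x ∈ T → Leads E x₀ (Sum.inr x)) ∧ Leads E x₀ (Sum.inl (D.v 0)) ∧
      Leads E x₀ (Sum.inl D.u) := by
  classical
  by_cases hex : ∃ m < D.k, D.b m = D.a
  · obtain ⟨j, hj, hja, hmax⟩ : ∃ j < D.k, D.b j = D.a ∧ ∀ m < D.k, j < m → D.b m ≠ D.a := by
      obtain ⟨m, hm, hma⟩ := hex
      have hs := Nat.findGreatest_spec (P := fun m => m < D.k ∧ D.b m = D.a) hm.le ⟨hm, hma⟩
      exact ⟨_, hs.1, hs.2, fun m' hm' hlt h =>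
        Nat.findGreatest_is_greatest hlt hm'.le ⟨hm', h⟩⟩
    have hj' : j + 1 < D.k := by
      refine lt_of_le_of_ne hj fun hjk => ?_
      have := D.path j hj
      rw [hja, hjk] at this
      exact D.ne j hj.le (D.codet _ _ _ _ this D.edge)
    have hP := presents_closed_ladder hr hj' hja (hmax _ hj' (Nat.lt_succ_self j))
      (presents_ladder hr h (j := j + 2) hj' fun m hm hjm => hmax m hm (by omega))
    refine ⟨_, _, copy 0, hP, by simp [ladderStates], fun x c y h => Or.inl (.old h), ?_⟩
    generalize hE : (fun x c y => D.Ladder 0 (j + 2) x c y ∨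
      (x = copy j ∧ c = Sum.inl (D.b (j + 1)) ∧ y = shift (j + 2))) = E
    have hL : ∀ {x c y}, D.Ladder 0 (j + 2) x c y → E x c y := fun h => hE ▸ Or.inl h
    have hcopy : ∀ l ≤ D.k, Leads E (copy 0) (copy l) := by
      intro l
      induction l with
      | zero => exact fun _ => .refl
      | succ l ih => exact fun hl => (ih (by omega)).tail ⟨_, hL (.chain (Nat.zero_le _) hl)⟩
    have hshift : ∀ l, j + 2 ≤ l → l ≤ D.k → Leads E (copy 0) (shift l) := by
      intro l hl
      induction l, hl using Nat.le_induction with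
      | base =>
        exact fun _ => (hcopy j hj.le).tail ⟨Sum.inl (D.b (j + 1)), hE ▸ Or.inr ⟨rfl, rfl, rfl⟩⟩
      | succ l hl ih => exact fun hlk => (ih (by omega)).tail ⟨_, hL (.rail hl hlk)⟩
    refine ⟨?_, (hcopy 0 (Nat.zero_le _)).tail ⟨_, hL (.down le_rfl (Nat.zero_le _))⟩,
      (hshift D.k hj' le_rfl).tail ⟨_, hL (.exit hj')⟩⟩
    rintro (l | l) hl
    · exact hcopy l ((hl l).1 rfl).2
    · exact hshift l ((hl l).2 rfl).1 ((hl l).2 rfl).2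
  · push Not at hex
    have hP := presents_ladder hr h (Nat.zero_le _) fun m hm _ => hex m hm
    refine ⟨_, _, shift 0, hP, by simp [ladderStates], fun x c y h => .old h, ?_⟩
    have hshift : ∀ l ≤ D.k, Leads (D.Ladder 0 0) (shift 0) (shift l) := by
      intro l
      induction l with
      | zero => exact fun _ => .refl
      | succ l ih => exact fun hl => (ih (by omega)).tail ⟨_, .rail (Nat.zero_le _) hl⟩
    have hcopy : ∀ l ≤ D.k, Leads (D.Ladder 0 0) (shift 0) (copy l) := fun l hl =>
      (hshift l hl).tail ⟨_, .rung (Nat.zero_le _) hl⟩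
    refine ⟨?_, (hcopy 0 (Nat.zero_le _)).tail ⟨_, .down le_rfl (Nat.zero_le _)⟩,
      (hshift D.k le_rfl).tail ⟨_, .exit (Nat.zero_le _)⟩⟩
    rintro (l | l) hl
    · exact hcopy l ((hl l).1 rfl).2
    · exact hshift l ((hl l).2 rfl).2

end Zigzag

/-! ### Induction on the number of unreachable states -/

/-- The labelled transition relation of an HDA. -/
def Edge (A : HDA.{u} L) (x : A.cube 0) (c : L) (y : A.cube 0) : Prop :=
  ∃ e, A.face false 0 e = x ∧ A.label e = c ∧ A.face true 0 e = y

lemma Reachable.tail_edge {A : HDA.{u} L} {x y : A.cube 0} {c : L} (hx : A.Reachable x)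
    (h : A.Edge x c y) : A.Reachable y := by
  obtain ⟨e, h0, -, h1⟩ := h
  exact hx.tail ⟨e, h0, h1⟩

lemma Reachable.leads {A : HDA.{u} L} {s : A.cube 0} (hs : A.Reachable s) :
    Leads A.Edge A.init s :=
  Relation.ReflTransGen.mono (fun _ _ ⟨e, h0, h1⟩ => ⟨A.label e, e, h0, rfl, h1⟩) _ _ hs

/-- If some state is not reachable, then there is a zigzag from the initial state to an unreachable
state. -/
lemma exists_zigzag {A : HDA.{u} L} (hconn : A.IsConnected) (hbi : A.IsBideterministic)
    {s : A.cube 0} (hs : ¬ A.Reachable s) :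
    ∃ D : Zigzag (A.cube 0) L, D.E = A.Edge ∧ D.v 0 = A.init ∧ ¬ A.Reachable D.u := by
  obtain ⟨e, hu, ht⟩ := exists_edge_of_not_reachable hconn hs
  obtain ⟨k, w, h0, hk, hw, hinj⟩ := ht.exists_injective_path
  have hwr : ∀ l ≤ k, A.Reachable (w l) := by
    intro l
    induction l with
    | zero => exact fun _ => h0 ▸ .refl
    | succ l ih => exact fun hl => (ih (by omega)).tail (hw l hl)
  have hlab : ∀ l, ∃ c, l < k → A.Edge (w l) c (w (l + 1)) := by
    intro l
    by_cases hl : l < k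
    · obtain ⟨e', h⟩ := hw l hl
      exact ⟨A.label e', fun _ => ⟨e', h.1, rfl, h.2⟩⟩
    · exact ⟨A.label e, fun h => absurd h hl⟩
  choose b hb using hlab
  refine ⟨⟨A.Edge, ?_, ?_, k, w, b, hb, hinj, A.face false 0 e, A.label e, ⟨e, rfl, rfl, hk.symm⟩,
    fun l hl c h => hu ((hwr l hl).tail_edge h), fun l hl h => hu (h ▸ hwr l hl)⟩, rfl, h0, hu⟩
  · rintro x c y y' ⟨e, h1, h2, rfl⟩ ⟨e', h1', h2', rfl⟩
    rw [hbi.1 e e' (h1.trans h1'.symm) (h2.trans h2'.symm)]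
  · rintro x x' c y ⟨e, rfl, h2, h3⟩ ⟨e', rfl, h2', h3'⟩
    rw [hbi.2 e e' (h3.trans h3'.symm) (h2.trans h2'.symm)]

/-- The starting point of the construction of the ladder is `A` itself, without any new states but
with a new label, which is greater than the old ones. -/
lemma presents_relabel {A : HDA.{u} L} (hbi : A.IsBideterministic) {r : L → L → Prop}
    (hfull : A.IsFull r) (D : Zigzag (A.cube 0) L) (hD : D.E = A.Edge) :
    Presents (Sum.Lex r emptyRelation) A.Realization (D.ladderStates (D.k + 1) (D.k + 1))
      (D.Ladder (D.k + 1) (D.k + 1)) := by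
  have := A.finite_labels
  refine ⟨A.relabel Sum.inl, Sum.inl, hbi.relabel Sum.inl_injective,
    hfull.relabel Sum.inl_injective (fun _ _ => Sum.lex_inl_inl), Sum.inl_injective, ?_, ?_,
    ⟨.refl _⟩⟩
  · ext x
    constructor
    · rintro ⟨s, rfl⟩ l
      exact ⟨by simp, by simp⟩
    · intro h
      rcases x with x | l | l
      · exact ⟨x, rfl⟩
      · have := (h l).1 rfl
        omega
      · have := (h l).2 rfl
        omega
  · intro x c y
    constructor
    · intro h
      cases h with
      | old h =>
        rw [hD] at h
        obtain ⟨e, rfl, rfl, rfl⟩ := h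
        exact ⟨e, rfl, rfl, rfl⟩
      | _ => omega
    · rintro ⟨e, rfl, rfl, rfl⟩
      exact .old (hD ▸ ⟨e, rfl, rfl, rfl⟩)

lemma exists_fewer_unreachable {A : HDA.{u} L} {r : L → L → Prop} (hr : IsStrictTotalOrder L r)
    (hbi : A.IsBideterministic) (hfull : A.IsFull r) (hconn : A.IsConnected)
    (hfin : {s : A.cube 0 | ¬ A.Reachable s}.Finite) {s : A.cube 0} (hs : ¬ A.Reachable s) :
    ∃ (M : Type v) (B : HDA.{u} M) (r' : M → M → Prop), IsStrictTotalOrder M r' ∧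
      B.IsBideterministic ∧ B.IsFull r' ∧ Nonempty (B.Realization ≃ₕ A.Realization) ∧
      {s : B.cube 0 | ¬ B.Reachable s}.Finite ∧
      {s : B.cube 0 | ¬ B.Reachable s}.ncard < {s : A.cube 0 | ¬ A.Reachable s}.ncard := by
  obtain ⟨D, hD, hv, hu⟩ := exists_zigzag hconn hbi hs
  have hr' : IsStrictTotalOrder (Zigzag.Label L) (Sum.Lex r emptyRelation) :=
    { }
  obtain ⟨T, E, x₀, hP, hx₀, hE, hnew, hstart, hDu⟩ :=
    Zigzag.exists_presents hr' (presents_relabel hbi hfull D hD)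
  obtain ⟨B, hBbi, hBfull, hφ, ν, hν, hνT, hreach⟩ := hP.exists_hda hx₀
  have hold : ∀ s, A.Reachable s → Leads E x₀ (Sum.inl s) := by
    intro s hs
    rw [hv] at hstart
    refine hstart.trans (Relation.ReflTransGen.lift Sum.inl ?_ _ _ hs.leads)
    rintro x y ⟨c, h⟩
    exact ⟨Sum.inl c, hE x c y (hD ▸ h)⟩
  have hsub : ν '' {s | ¬ B.Reachable s} ⊆
      Sum.inl '' ({s : A.cube 0 | ¬ A.Reachable s} \ {D.u}) := by
    rintro _ ⟨s, hs, rfl⟩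
    rcases h : ν s with x | x
    · refine ⟨x, ⟨fun hx => hs (hreach s (h ▸ hold x hx)), ?_⟩, rfl⟩
      rintro rfl
      exact hs (hreach s (h ▸ hDu))
    · exact (hs (hreach s (h ▸ hnew x (h ▸ hνT s)))).elim
  have hfin' : (Sum.inl '' ({s : A.cube 0 | ¬ A.Reachable s} \ {D.u}) :
      Set (Zigzag.State (A.cube 0))).Finite := hfin.sdiff.image _
  refine ⟨_, B, _, hr', hBbi, hBfull, hφ, (hfin'.subset hsub).of_finite_image hν.injOn, ?_⟩
  calc {s : B.cube 0 | ¬ B.Reachable s}.ncard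
      = (ν '' {s | ¬ B.Reachable s}).ncard := (Set.ncard_image_of_injective _ hν).symm
    _ ≤ (Sum.inl '' ({s : A.cube 0 | ¬ A.Reachable s} \ {D.u}) :
          Set (Zigzag.State (A.cube 0))).ncard := Set.ncard_le_ncard hsub hfin'
    _ = ({s : A.cube 0 | ¬ A.Reachable s} \ {D.u}).ncard :=
      Set.ncard_image_of_injective _ Sum.inl_injective
    _ < _ := Set.ncard_sdiff_singleton_lt_of_mem hu hfin

lemma exists_accessible : ∀ (n : ℕ) {L : Type v} (A : HDA.{u} L) (r : L → L → Prop),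
    IsStrictTotalOrder L r → A.IsBideterministic → A.IsFull r → A.IsConnected →
    {s : A.cube 0 | ¬ A.Reachable s}.Finite → {s : A.cube 0 | ¬ A.Reachable s}.ncard = n →
    ∃ (M : Type v) (B : HDA.{u} M) (r' : M → M → Prop), IsStrictTotalOrder M r' ∧
      B.IsAccessible ∧ B.IsBideterministic ∧ B.IsFull r' ∧
      Nonempty (B.Realization ≃ₕ A.Realization) := by
  intro n
  induction n using Nat.strong_induction_on with
  | _ n ih =>
    intro L A r hr hbi hfull hconn hfin hn
    by_cases hacc : A.IsAccessible
    · exact ⟨L, A, r, hr, hacc, hbi, hfull, ⟨.refl _⟩⟩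
    · obtain ⟨s, hs⟩ := not_forall.1 hacc
      obtain ⟨M, B, r', hr', hBbi, hBfull, ⟨φ⟩, hBfin, hlt⟩ :=
        exists_fewer_unreachable hr hbi hfull hconn hfin hs
      have : PathConnectedSpace A.Realization := hconn
      obtain ⟨M', C, r'', hr'', hCacc, hCbi, hCfull, ⟨ψ⟩⟩ :=
        ih _ (hn ▸ hlt) B r' hr' hBbi hBfull φ.symm.pathConnectedSpace hBfin rfl
      exact ⟨M', C, r'', hr'', hCacc, hCbi, hCfull, ⟨ψ.trans φ⟩⟩

end HDA

theorem mainTheorem3 {L : Type v} (A : HDA.{u, v} L) (r : L → L → Prop)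
    (hr : IsStrictTotalOrder L r) (hbidet : A.IsBideterministic)
    (hmodel : A.IsHDAModelOfOneSkeleton r) (hconn : A.IsConnected)
    (hfin : {s : A.cube 0 | ¬ A.Reachable s}.Finite) :
    ∃ (M : Type v) (B : HDA.{u, v} M) (r' : M → M → Prop),
      IsStrictTotalOrder M r' ∧ B.IsAccessible ∧ B.IsBideterministic ∧
      B.IsHDAModelOfOneSkeleton r' ∧ Nonempty (B.Realization ≃ₕ A.Realization) := by
  obtain ⟨M, B, r', hr', hacc, hbi, hfull, hφ⟩ :=
    HDA.exists_accessible _ A r hr hbidet hmodel.isFull hconn hfin rfl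
  exact ⟨M, B, r', hr', hacc, hbi, hfull.isHDAModelOfOneSkeleton hbi.1.isExtensional, hφ⟩
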